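/- **Language.** Let $\mathsf{Prop}$ and $\mathsf{Nom}$ be sets of propositional variables and nominals. Formulas of the expanded modal language are built from $p\in\mathsf{Prop}$, $\mathbf i\in\mathsf{Nom}$, $\top,\bot$ by $\neg,\land,\lor,\to,\Box,\Diamond,\blacklozenge,\blacksquare$ (all taken as primitive). A formula is *basic* if it contains no nominal and no $\blacklozenge,\blacksquare$; it is *pure* if it contains no propositional variable. An *inequality* is an expression $\varphi\le\psi$; a *system* $(S,\mathsf{Ineq})$ consists of a finite set $S$ of inequalities and an inequality $\mathsf{Ineq}$. **Frames.** For a partial order $(W,\sqsubseteq)$ let $\mathsf{cl}(X)=\{x:\exists y\sqsubseteq x,\ y\in X\}$ and $\mathsf{int}(X)=\{x:\forall y\sqsubseteq x,\ y\in X\}$; $X$ is *regular open* if $\mathsf{int}(\mathsf{cl}(X))=X$, and $\mathsf{ro}(X)$ is the least regular open set containing $X$. A *possibility frame* is $(W,\sqsubseteq,R,\mathsf P)$ with $W\ne\emptyset$, $R\subseteq W^2$, and $\mathsf P$ a Boolean subalgebra of the regular open sets closed under $X\mapsto\{w: R[w]\subseteq X\}$; it is *full* if $\mathsf P$ is the set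 of all regular open sets. Given $V:\mathsf{Prop}\to\mathsf P$ and an interpretation of each nominal $\mathbf i$ by a set $V(\mathbf i)=\mathsf{ro}(\{w_{\mathbf i}\})$, satisfaction is: $w\vDash p$ (resp. $\mathbf i$) iff $w\in V(p)$ (resp. $V(\mathbf i)$); $\top$ always, $\bot$ never, $\land$ pointwise; $w\vDash\neg\varphi$ iff $\forall v\sqsubseteq w$, $v\nvDash\varphi$; $w\vDash\varphi\lor\psi$ iff $\forall v\sqsubseteq w\,\exists u\sqsubseteq v$ ($u\vDash\varphi$ or $u\vDash\psi$); $w\vDash\varphi\to\psi$ iff $\forall v\sqsubseteq w$ ($v\vDash\varphi\Rightarrow v\vDash\psi$); $w\vDash\Box\varphi$ iff $\forall v(Rwv\Rightarrow v\vDash\varphi)$; $w\vDash\Diamond\varphi$ iff $\forall v\sqsubseteq w\,\exists u(Rvu\ \&\ \exists t\sqsubseteq u,\ t\vDash\varphi)$; $w\vDash\blacklozenge\varphi$ iff $\forall v\sqsubseteq w\,\exists u\sqsubseteq v\,\exists t\sqsupseteq u\,\exists s(Rst\ \&\ s\vDash\varphi)$; $w\vDash\blacksquare\varphi$ iff $\forall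 v\sqsubseteq w\,\forall u\sqsupseteq v\,\forall t(Rtu\Rightarrow\exists s\sqsubseteq t,\ s\vDash\varphi)$. (On a full frame $\blacklozenge$ and $\blacksquare$ are thus the left adjoint of $\Box$ and the right adjoint of $\Diamond$ on regular open sets.) $\mathbb F\vDash\varphi\le\psi$ means that for every such $V$ and every $w\in W$, $w\vDash\varphi$ implies $w\vDash\psi$. **Translation.** $ST_x$ maps formulas to first-order formulas over $\sqsubseteq$, $R$, unary predicates $P_p$ ($p\in\mathsf{Prop}$) and individual symbols $i$ ($\mathbf i\in\mathsf{Nom}$): $ST_x(p)=P_px$, $ST_x(\mathbf i)=(\forall y\sqsubseteq x)(\exists z\sqsubseteq y)(\exists z'\sqsupseteq z)(i=z')$, and the other clauses are the satisfaction clauses above written as first-order formulas. For a list of pure systems $(S_1,\mathsf{Ineq}_1),\dots,(S_n,\mathsf{Ineq}_n)$ with $\mathsf{Ineq}_k=(\varphi_k\le\psi_k)$ the first-order output is the sentence over $\sqsubseteq,R$ $$\bigwedge_{k}\forall\vec{j_k}\Big(\bigwedge_{(\xi\le\chi)\in S_k}\forall x(ST_x(\xi)\to ST_x(\chi))\to\forall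 x(ST_x(\varphi_k)\to ST_x(\psi_k))\Big),$$ where $\vec{j_k}$ are the individual symbols occurring in the $k$-th conjunct. **Signs.** Label the root of the tree of $\varphi$ by $+$ or $-$ and pass signs to children unchanged, except that $\neg$ and the first argument of $\to$ reverse them. $\varphi$ is positive (negative) in $p$ if all occurrences of $p$ in $+\varphi$ are signed $+$ (resp. $-$). SLR nodes are $+\land,+\Diamond,+\neg,-\lor,-\Box,-\neg,-\to$. $\varphi(!x)$ denotes a formula with exactly one occurrence of a placeholder $x$. **The algorithm.** A run of ALBA on an inequality $\varphi\le\psi$ of basic formulas: *Stage 1.* Starting from $\{\varphi\le\psi\}$, finitely many times replace an inequality in the set by the result of a rule: (a) distribution, in the trees $+\text{lhs}$ and $-\text{rhs}$, at any node: distribute $+\Diamond$, $+\land$, $-\neg$, $-\to$ (in its first argument) over a child $+\lor$, and $-\Box$, $-\lor$, $+\neg$, $-\to$ (in its second argument) over a child $-\land$ (where $\neg$ and the first argument of $\to$ exchange $\lor$ and $\land$); (b) if $\alpha$ is negative and $\beta$ positive in $p$: $\alpha(p)\le\beta(p)\rightsquigarrow\alpha(\bot)\le\beta(\bot)$ and $\beta(p)\le\alpha(p)\rightsquigarrow\beta(\top)\le\alpha(\top)$;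 (c) splitting: $\alpha\le\beta\land\gamma\rightsquigarrow\alpha\le\beta,\ \alpha\le\gamma$ and $\alpha\lor\beta\le\gamma\rightsquigarrow\alpha\le\gamma,\ \beta\le\gamma$. *Stage 2.* Each resulting inequality $e$ gives the initial system $(\emptyset,e)$, which is rewritten finitely many times by: (a) approximation: if the branch of $x$ in $+\varphi'(!x)$ consists, apart from $x$, of SLR nodes, $\gamma$ is basic and $\mathbf i$ does not occur in the system, then $(S,\varphi'(\gamma)\le\psi')\rightsquigarrow(S\cup\{\mathbf i\le\gamma\},\varphi'(\mathbf i)\le\psi')$ if $x$ is signed $+$, and $\rightsquigarrow(S\cup\{\gamma\le\neg\mathbf i\},\varphi'(\neg\mathbf i)\le\psi')$ if $x$ is signed $-$; likewise $(S,\varphi'\le\psi'(\gamma))\rightsquigarrow(S\cup\{\mathbf i\le\gamma\},\varphi'\le\psi'(\mathbf i))$, resp. $(S\cup\{\gamma\le\neg\mathbf i\},\varphi'\le\psi'(\neg\mathbf i))$, with the signs taken in $-\psi'(!x)$; (b) residuation, replacing an inequality in $S$: $\Diamond\gamma\le\delta\rightsquigarrow\gamma\le\blacksquare\delta$; $\neg\gamma\le\delta\rightsquigarrow\neg\delta\le\gamma$;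 $\gamma\le\Box\delta\rightsquigarrow\blacklozenge\gamma\le\delta$; $\gamma\le\neg\delta\rightsquigarrow\delta\le\neg\gamma$; $\gamma\land\delta\le\beta\rightsquigarrow\gamma\le\delta\to\beta$ or $\delta\le\gamma\to\beta$; $\gamma\le\delta\lor\beta\rightsquigarrow\gamma\land\neg\delta\le\beta$ or $\gamma\land\neg\beta\le\delta$; $\gamma\le\delta\to\beta\rightsquigarrow\gamma\land\delta\le\beta$ or $\delta\le\gamma\to\beta$; (c) the splitting rules, applied to an inequality in $S$; (d) Ackermann rules, for $p$ not occurring in any $\alpha_i$ or in $\mathsf{Ineq}$: $(\{\alpha_i\le p\}_{i\le n}\cup\{\beta_j(p)\le\gamma_j(p)\}_{j\le m},\mathsf{Ineq})\rightsquigarrow(\{\beta_j(\bigvee_i\alpha_i)\le\gamma_j(\bigvee_i\alpha_i)\}_{j\le m},\mathsf{Ineq})$ if all $\beta_j$ are positive and all $\gamma_j$ negative in $p$; and $(\{p\le\alpha_i\}_{i\le n}\cup\{\beta_j(p)\le\gamma_j(p)\}_{j\le m},\mathsf{Ineq})\rightsquigarrow(\{\beta_j(\bigwedge_i\alpha_i)\le\gamma_j(\bigwedge_i\alpha_i)\}_{j\le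 m},\mathsf{Ineq})$ if all $\beta_j$ are negative and all $\gamma_j$ positive in $p$ (here $n,m\ge 0$, $\bigvee\emptyset=\bot$, $\bigwedge\emptyset=\top$). *Stage 3.* The run *succeeds* if every system has been rewritten to a pure one; it then outputs the first-order output $\mathsf{FO}(\varphi\le\psi)$ of these pure systems. Runs need not be exhaustive in Stage 1 nor use only maximal SLR branches in Stage 2(a); runs that do are included. **Theorem (Soundness).** Let $\varphi,\psi$ be basic formulas. If some run of ALBA succeeds on $\varphi\le\psi$ and outputs $\mathsf{FO}(\varphi\le\psi)$, then for every full possibility frame $\mathbb F$, $$\mathbb F\vDash\varphi\le\psi\quad\text{iff}\quad\mathbb F\vDash\mathsf{FO}(\varphi\le\psi).$$ -/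

import Mathlib

namespace PossALBA

open FirstOrder FirstOrder.Language

universe u v w

/-! ## The expanded modal language -/

/-- Formulas of the expanded modal language over propositional variables `P` and nominals `N`.
The abbreviations `⊤, ⊥, ∨, →, ◇, ■` are taken as primitive symbols; `bdia` is the black diamond
and `bbox` the black box. -/
inductive MForm (P : Type u) (N : Type v) : Type (max u v)
  | prop (p : P) : MForm P N
  | nom (i : N) : MForm P N
  | top : MForm P N
  | bot : MForm P N
  | neg (a : MForm P N) : MForm P N
  | and (a b : MForm P N) : MForm P N
  | or (a b : MForm P N) : MForm P N
  | imp (a b : MForm P N) : MForm P N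
  | box (a : MForm P N) : MForm P N
  | dia (a : MForm P N) : MForm P N
  | bdia (a : MForm P N) : MForm P N
  | bbox (a : MForm P N) : MForm P N
  deriving DecidableEq

/-- An inequality `lhs ≤ rhs`. -/
@[ext]
structure Ineq (P : Type u) (N : Type v) : Type (max u v) where
  lhs : MForm P N
  rhs : MForm P N
  deriving DecidableEq

/-- A system `(S, Ineq)`, that is, the quasi-inequality `& S ⇒ Ineq`. -/
@[ext]
structure System (P : Type u) (N : Type v) : Type (max u v) where
  prem : Finset (Ineq P N)
  concl : Ineq P N

/-- The two signs of a signed generation tree. -/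
inductive Sign : Type
  | pos : Sign
  | neg : Sign

/-- The opposite sign. -/
def Sign.flip : Sign → Sign
  | .pos => .neg
  | .neg => .pos

namespace MForm

variable {P : Type u} {N : Type v}

/-- The formula belongs to the basic modal language: no nominals and no black connectives. -/
def IsBasic : MForm P N → Prop
  | prop _ => True
  | nom _ => False
  | top => True
  | bot => True
  | neg a => a.IsBasic
  | and a b => a.IsBasic ∧ b.IsBasic
  | or a b => a.IsBasic ∧ b.IsBasic
  | imp a b => a.IsBasic ∧ b.IsBasic
  | box a => a.IsBasic
  | dia a => a.IsBasic
  | bdia _ => False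
  | bbox _ => False

/-- The propositional variable `p` occurs in the formula. -/
def Occ (p : P) : MForm P N → Prop
  | prop q => q = p
  | nom _ => False
  | top => False
  | bot => False
  | neg a => a.Occ p
  | and a b => a.Occ p ∨ b.Occ p
  | or a b => a.Occ p ∨ b.Occ p
  | imp a b => a.Occ p ∨ b.Occ p
  | box a => a.Occ p
  | dia a => a.Occ p
  | bdia a => a.Occ p
  | bbox a => a.Occ p

/-- The nominal `i` occurs in the formula. -/
def NomOcc (i : N) : MForm P N → Prop
  | prop _ => False
  | nom j => j = i
  | top => False
  | bot => False
  | neg a => a.NomOcc i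
  | and a b => a.NomOcc i ∨ b.NomOcc i
  | or a b => a.NomOcc i ∨ b.NomOcc i
  | imp a b => a.NomOcc i ∨ b.NomOcc i
  | box a => a.NomOcc i
  | dia a => a.NomOcc i
  | bdia a => a.NomOcc i
  | bbox a => a.NomOcc i

/-- `SignedOcc s p r φ`: when the root of the generation tree of `φ` is given the sign `r`,
some leaf `p` receives the sign `s`. -/
def SignedOcc (s : Sign) (p : P) : Sign → MForm P N → Prop
  | r, prop q => q = p ∧ r = s
  | _, nom _ => False
  | _, top => False
  | _, bot => False
  | r, neg a => SignedOcc s p r.flip a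
  | r, and a b => SignedOcc s p r a ∨ SignedOcc s p r b
  | r, or a b => SignedOcc s p r a ∨ SignedOcc s p r b
  | r, imp a b => SignedOcc s p r.flip a ∨ SignedOcc s p r b
  | r, box a => SignedOcc s p r a
  | r, dia a => SignedOcc s p r a
  | r, bdia a => SignedOcc s p r a
  | r, bbox a => SignedOcc s p r a

/-- `φ` is positive in `p`: every occurrence of `p` in the tree `+φ` is signed `+`. -/
def PositiveIn (p : P) (φ : MForm P N) : Prop := ¬ SignedOcc .neg p .pos φ

/-- `φ` is negative in `p`: every occurrence of `p` in the tree `+φ` is signed `-`. -/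
def NegativeIn (p : P) (φ : MForm P N) : Prop := ¬ SignedOcc .pos p .pos φ

/-- Replacement of every occurrence of `p` by `θ`. -/
def subst [DecidableEq P] (p : P) (θ : MForm P N) : MForm P N → MForm P N
  | prop q => if q = p then θ else prop q
  | nom i => nom i
  | top => top
  | bot => bot
  | neg a => neg (subst p θ a)
  | and a b => and (subst p θ a) (subst p θ b)
  | or a b => or (subst p θ a) (subst p θ b)
  | imp a b => imp (subst p θ a) (subst p θ b)
  | box a => box (subst p θ a)
  | dia a => dia (subst p θ a)
  | bdia a => bdia (subst p θ a)
  | bbox a => bbox (subst p θ a)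

/-- A pure formula, that is, a formula over the empty set of propositional variables, regarded as
a formula over `P`. -/
def ofPure : MForm Empty N → MForm P N
  | prop q => q.elim
  | nom i => nom i
  | top => top
  | bot => bot
  | neg a => neg (ofPure a)
  | and a b => and (ofPure a) (ofPure b)
  | or a b => or (ofPure a) (ofPure b)
  | imp a b => imp (ofPure a) (ofPure b)
  | box a => box (ofPure a)
  | dia a => dia (ofPure a)
  | bdia a => bdia (ofPure a)
  | bbox a => bbox (ofPure a)

/-- The finite join `⋁ αᵢ` of a list of formulas (`⊥` for the empty list). -/
def bigOr : List (MForm P N) → MForm P N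
  | [] => bot
  | [a] => a
  | a :: b :: l => or a (bigOr (b :: l))

/-- The finite meet `⋀ αᵢ` of a list of formulas (`⊤` for the empty list). -/
def bigAnd : List (MForm P N) → MForm P N
  | [] => top
  | [a] => a
  | a :: b :: l => and a (bigAnd (b :: l))

end MForm

/-! ## Contexts with one hole -/

/-- `φ(!x)` with exactly one occurrence of the placeholder `x` (the `hole`), which is not in the
scope of a black connective. -/
inductive Ctx (P : Type u) (N : Type v) : Type (max u v)
  | hole : Ctx P N
  | neg (C : Ctx P N) : Ctx P N
  | andL (C : Ctx P N) (b : MForm P N) : Ctx P N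
  | andR (a : MForm P N) (C : Ctx P N) : Ctx P N
  | orL (C : Ctx P N) (b : MForm P N) : Ctx P N
  | orR (a : MForm P N) (C : Ctx P N) : Ctx P N
  | impL (C : Ctx P N) (b : MForm P N) : Ctx P N
  | impR (a : MForm P N) (C : Ctx P N) : Ctx P N
  | box (C : Ctx P N) : Ctx P N
  | dia (C : Ctx P N) : Ctx P N

namespace Ctx

variable {P : Type u} {N : Type v}

/-- `φ(γ/!x)`. -/
def fill : Ctx P N → MForm P N → MForm P N
  | hole, γ => γ
  | neg C, γ => .neg (C.fill γ)
  | andL C b, γ => .and (C.fill γ) b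
  | andR a C, γ => .and a (C.fill γ)
  | orL C b, γ => .or (C.fill γ) b
  | orR a C, γ => .or a (C.fill γ)
  | impL C b, γ => .imp (C.fill γ) b
  | impR a C, γ => .imp a (C.fill γ)
  | box C, γ => .box (C.fill γ)
  | dia C, γ => .dia (C.fill γ)

/-- The sign received by the placeholder when the root is signed `r`. -/
def holeSign : Ctx P N → Sign → Sign
  | hole, r => r
  | neg C, r => C.holeSign r.flip
  | andL C _, r => C.holeSign r
  | andR _ C, r => C.holeSign r
  | orL C _, r => C.holeSign r
  | orR _ C, r => C.holeSign r
  | impL C _, r => C.holeSign r.flip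
  | impR _ C, r => C.holeSign r
  | box C, r => C.holeSign r
  | dia C, r => C.holeSign r

/-- With the root signed `r`, every node on the branch from the root to the placeholder (the
placeholder itself excepted) is SLR, i.e. one of `+∧, +◇, +¬, -∨, -□, -¬, -→`. -/
def IsSLR : Ctx P N → Sign → Prop
  | hole, _ => True
  | neg C, r => C.IsSLR r.flip
  | andL C _, r => r = .pos ∧ C.IsSLR r
  | andR _ C, r => r = .pos ∧ C.IsSLR r
  | orL C _, r => r = .neg ∧ C.IsSLR r
  | orR _ C, r => r = .neg ∧ C.IsSLR r
  | impL C _, r => r = .neg ∧ C.IsSLR r.flip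
  | impR _ C, r => r = .neg ∧ C.IsSLR r
  | box C, r => r = .neg ∧ C.IsSLR r
  | dia C, r => r = .pos ∧ C.IsSLR r

end Ctx

/-! ## Possibility frames -/

section Downset

variable {W : Type w} [PartialOrder W]

/-- Closure in the downset topology (`⊑` is written `≤`). -/
def cl (X : Set W) : Set W := {x | ∃ y, y ≤ x ∧ y ∈ X}

/-- Interior in the downset topology. -/
def int (X : Set W) : Set W := {x | ∀ y, y ≤ x → y ∈ X}

/-- Regular open sets of the downset topology. -/
def IsRO (X : Set W) : Prop := int (cl X) = X

/-- The regular open closure: the least regular open set that contains `X`. -/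
def ro (X : Set W) : Set W := ⋂₀ {Y | IsRO Y ∧ X ⊆ Y}

end Downset

/-- A possibility frame `(W, ⊑, R, P)` with domain `W` and refinement relation `≤`. The admissible
sets form a sub-Boolean algebra of the regular open sets that is closed under the box of `R`. -/
structure PossibilityFrame (W : Type w) [PartialOrder W] where
  nonempty : Nonempty W
  R : W → W → Prop
  admissible : Set (Set W)
  isRO_of_mem : ∀ X ∈ admissible, IsRO X
  empty_mem : ∅ ∈ admissible
  univ_mem : Set.univ ∈ admissible
  inter_mem : ∀ X ∈ admissible, ∀ Y ∈ admissible, X ∩ Y ∈ admissible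
  join_mem : ∀ X ∈ admissible, ∀ Y ∈ admissible, int (cl (X ∪ Y)) ∈ admissible
  compl_mem : ∀ X ∈ admissible, int Xᶜ ∈ admissible
  box_mem : ∀ X ∈ admissible, {x | ∀ y, R x y → y ∈ X} ∈ admissible

/-! ## The correspondence language and the regular open translation -/

/-- The non-logical relation symbols of the correspondence language: refinement `⊑`,
accessibility `R`, and a unary predicate for each propositional variable. -/
inductive CorrRel (Q : Type u) : ℕ → Type u
  | refines : CorrRel Q 2
  | acc : CorrRel Q 2
  | pred (q : Q) : CorrRel Q 1

/-- The first-order correspondence language over the propositional variables `Q`. Over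
`Q = Empty` only the two binary symbols remain. The individual symbols that
correspond to nominals are treated as (free) individual variables, so that they can be
quantified. -/
def corrLang (Q : Type u) : FirstOrder.Language.{0, u} := ⟨fun _ => Empty, CorrRel Q⟩

section Translation

variable {Q : Type u} {N : Type v} {n : ℕ}

/-- The relation symbol `⊑`. -/
def refSymb : (corrLang Q).Relations 2 := CorrRel.refines

/-- The relation symbol `R`. -/
def accSymb : (corrLang Q).Relations 2 := CorrRel.acc

/-- The unary predicate symbol of the propositional variable `q`. -/
def predSymb (q : Q) : (corrLang Q).Relations 1 := CorrRel.pred q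

/-- `x ⊑ y` for bound variables `x`, `y`. -/
def fRef (x y : Fin n) : (corrLang Q).BoundedFormula N n :=
  refSymb.boundedFormula₂ (Term.var (Sum.inr x)) (Term.var (Sum.inr y))

/-- `R x y` for bound variables `x`, `y`. -/
def fAcc (x y : Fin n) : (corrLang Q).BoundedFormula N n :=
  accSymb.boundedFormula₂ (Term.var (Sum.inr x)) (Term.var (Sum.inr y))

/-- `P_q x` for a bound variable `x`. -/
def fPred (q : Q) (x : Fin n) : (corrLang Q).BoundedFormula N n :=
  (predSymb q).boundedFormula₁ (Term.var (Sum.inr x))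

/-- `i = x` for the individual symbol `i` and a bound variable `x`. -/
def fEq (i : N) (x : Fin n) : (corrLang Q).BoundedFormula N n :=
  Term.bdEqual (Term.var (Sum.inl i)) (Term.var (Sum.inr x))

/-- `(∀ y ⊑ x) A(y)`; the variable `y` is `Fin.last n` in `A`. -/
def allBelow (x : Fin n) (A : (corrLang Q).BoundedFormula N (n + 1)) :
    (corrLang Q).BoundedFormula N n :=
  ((fRef (Fin.last n) x.castSucc).imp A).all

/-- `(∃ y ⊑ x) A(y)`. -/
def exBelow (x : Fin n) (A : (corrLang Q).BoundedFormula N (n + 1)) :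
    (corrLang Q).BoundedFormula N n :=
  (fRef (Fin.last n) x.castSucc ⊓ A).ex

/-- `(∀ y ⊒ x) A(y)`. -/
def allAbove (x : Fin n) (A : (corrLang Q).BoundedFormula N (n + 1)) :
    (corrLang Q).BoundedFormula N n :=
  ((fRef x.castSucc (Fin.last n)).imp A).all

/-- `(∃ y ⊒ x) A(y)`. -/
def exAbove (x : Fin n) (A : (corrLang Q).BoundedFormula N (n + 1)) :
    (corrLang Q).BoundedFormula N n :=
  (fRef x.castSucc (Fin.last n) ⊓ A).ex

/-- `∀ y (R x y → A(y))`. -/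
def allSucc (x : Fin n) (A : (corrLang Q).BoundedFormula N (n + 1)) :
    (corrLang Q).BoundedFormula N n :=
  ((fAcc x.castSucc (Fin.last n)).imp A).all

/-- `∃ y (R x y ∧ A(y))`. -/
def exSucc (x : Fin n) (A : (corrLang Q).BoundedFormula N (n + 1)) :
    (corrLang Q).BoundedFormula N n :=
  (fAcc x.castSucc (Fin.last n) ⊓ A).ex

/-- `∀ y (R y x → A(y))`. -/
def allPred (x : Fin n) (A : (corrLang Q).BoundedFormula N (n + 1)) :
    (corrLang Q).BoundedFormula N n :=
  ((fAcc (Fin.last n) x.castSucc).imp A).all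

/-- `∃ y (R y x ∧ A(y))`. -/
def exPred (x : Fin n) (A : (corrLang Q).BoundedFormula N (n + 1)) :
    (corrLang Q).BoundedFormula N n :=
  (fAcc (Fin.last n) x.castSucc ⊓ A).ex

/-- Syntactic regular open closure `(∀ y ⊑ x)(∃ z ⊑ y)(∃ z' ⊒ z) A(z')`; the variable `z'` is
`Fin.last (n + 2)` in `A`. -/
def roClosure (x : Fin n) (A : (corrLang Q).BoundedFormula N (n + 1 + 1 + 1)) :
    (corrLang Q).BoundedFormula N n :=
  allBelow x (exBelow (Fin.last n) (exAbove (Fin.last (n + 1)) A))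

/-- The regular open translation `ST_x(φ)`, where `x` is one of the `n` bound variables in
scope. -/
def ST : MForm Q N → {n : ℕ} → Fin n → (corrLang Q).BoundedFormula N n
  | .prop q, _, x => fPred q x
  | .nom i, n, x => roClosure x (fEq i (Fin.last (n + 2)))
  | .top, _, _ => ⊤
  | .bot, _, _ => ⊥
  | .neg a, n, x => allBelow x (ST a (Fin.last n)).not
  | .and a b, _, x => ST a x ⊓ ST b x
  | .or a b, n, x =>
      allBelow x (exBelow (Fin.last n) (ST a (Fin.last (n + 1)) ⊔ ST b (Fin.last (n + 1))))
  | .imp a b, n, x => allBelow x ((ST a (Fin.last n)).imp (ST b (Fin.last n)))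
  | .box a, n, x => allSucc x (ST a (Fin.last n))
  | .dia a, n, x =>
      allBelow x (exSucc (Fin.last n) (exBelow (Fin.last (n + 1)) (ST a (Fin.last (n + 2)))))
  | .bdia a, n, x => roClosure x (exPred (Fin.last (n + 2)) (ST a (Fin.last (n + 3))))
  | .bbox a, n, x =>
      allBelow x (allAbove (Fin.last n) (allPred (Fin.last (n + 1))
        (exBelow (Fin.last (n + 2)) (ST a (Fin.last (n + 3))))))

/-- `∀ x (ST_x(φ) → ST_x(ψ))`. -/
def Ineq.toFO (e : Ineq Q N) : (corrLang Q).Formula N :=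
  BoundedFormula.all ((ST e.lhs (Fin.last 0)).imp (ST e.rhs (Fin.last 0)))

/-- The translation of a quasi-inequality: the conjunction of the translated premises implies the
translated conclusion. The individual symbols of the nominals are left free. -/
noncomputable def System.toFO (s : System Q N) : (corrLang Q).Formula N :=
  (Formula.iInf fun e : s.prem => e.1.toFO).imp s.concl.toFO

/-- The universal closure `∀ j⃗ A` over the individual symbols that occur in `A`. -/
noncomputable def univClosure [DecidableEq N] (A : (corrLang Q).Formula N) :
    (corrLang Q).Sentence :=
  Formula.iAlls A.freeVarFinset (Formula.relabel Sum.inr (A.restrictFreeVar id))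

/-- The first-order output: the conjunction, over a list of pure systems, of the universally
closed translations. -/
noncomputable def FO [DecidableEq N] (l : List (System Empty N)) : (corrLang Empty).Sentence :=
  (l.map fun s => univClosure s.toFO).foldr (· ⊓ ·) ⊤

end Translation

/-! ## Semantics on possibility frames -/

namespace PossibilityFrame

variable {P : Type u} {N : Type v} {W : Type w} [PartialOrder W]

/-- All regular open sets are admissible. -/
def IsFull (F : PossibilityFrame W) : Prop := F.admissible = {X | IsRO X}

/-- The satisfaction relation. `V` interprets the propositional variables, `U` the nominals. -/
def Sat (F : PossibilityFrame W) (V : P → Set W) (U : N → Set W) : W → MForm P N → Prop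
  | x, .prop p => x ∈ V p
  | x, .nom i => x ∈ U i
  | _, .top => True
  | _, .bot => False
  | x, .neg a => ∀ y, y ≤ x → ¬ F.Sat V U y a
  | x, .and a b => F.Sat V U x a ∧ F.Sat V U x b
  | x, .or a b => ∀ y, y ≤ x → ∃ z, z ≤ y ∧ (F.Sat V U z a ∨ F.Sat V U z b)
  | x, .imp a b => ∀ y, y ≤ x → F.Sat V U y a → F.Sat V U y b
  | x, .box a => ∀ y, F.R x y → F.Sat V U y a
  | x, .dia a => ∀ y, y ≤ x → ∃ z, F.R y z ∧ ∃ t, t ≤ z ∧ F.Sat V U t a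
  | x, .bdia a => ∀ y, y ≤ x → ∃ z, z ≤ y ∧ ∃ t, z ≤ t ∧ ∃ s, F.R s t ∧ F.Sat V U s a
  | x, .bbox a => ∀ y, y ≤ x → ∀ z, y ≤ z → ∀ t, F.R t z → ∃ s, s ≤ t ∧ F.Sat V U s a

/-- Validity of an inequality: global truth under all interpretations of propositional variables
by admissible sets and of nominals by regular open closures of singletons. -/
def Valid (F : PossibilityFrame W) (e : Ineq P N) : Prop :=
  ∀ (V : P → Set W) (U : N → Set W), (∀ p, V p ∈ F.admissible) → (∀ i, ∃ x, U i = ro {x}) →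
    ∀ x, F.Sat V U x e.lhs → F.Sat V U x e.rhs

/-- A frame as a structure for the part of the correspondence language without unary
predicates. -/
@[reducible]
def toStructure (F : PossibilityFrame W) : (corrLang Empty).Structure W where
  funMap := fun f _ => Empty.elim f
  RelMap := fun r =>
    match r with
    | .refines => fun xs => xs 0 ≤ xs 1
    | .acc => fun xs => F.R (xs 0) (xs 1)
    | .pred q => q.elim

/-- Truth of a first-order sentence in the symbols `⊑` and `R` on a frame. -/
def Models (F : PossibilityFrame W) (A : (corrLang Empty).Sentence) : Prop :=
  @Sentence.Realize (corrLang Empty) W F.toStructure A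

end PossibilityFrame

/-! ## The algorithm -/

section Algorithm

variable {P : Type u} {N : Type v}

/-- The local form of the distribution rules at a node of the given sign: the connective at that
node is distributed over a child `+∨` or a child `-∧`. -/
inductive Distr : Sign → MForm P N → MForm P N → Prop
  | dia (a b) : Distr .pos (.dia (.or a b)) (.or (.dia a) (.dia b))
  | andL (a b c) : Distr .pos (.and (.or a b) c) (.or (.and a c) (.and b c))
  | andR (a b c) : Distr .pos (.and c (.or a b)) (.or (.and c a) (.and c b))
  | negOr (a b) : Distr .neg (.neg (.or a b)) (.and (.neg a) (.neg b))
  | impL (a b c) : Distr .neg (.imp (.or a b) c) (.and (.imp a c) (.imp b c))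
  | box (a b) : Distr .neg (.box (.and a b)) (.and (.box a) (.box b))
  | orL (a b c) : Distr .neg (.or (.and a b) c) (.and (.or a c) (.or b c))
  | orR (a b c) : Distr .neg (.or c (.and a b)) (.and (.or c a) (.or c b))
  | negAnd (a b) : Distr .pos (.neg (.and a b)) (.or (.neg a) (.neg b))
  | impR (a b c) : Distr .neg (.imp c (.and a b)) (.and (.imp c a) (.imp c b))

/-- The splitting rules. -/
inductive Split [DecidableEq P] [DecidableEq N] : Ineq P N → Finset (Ineq P N) → Prop
  | and (a b c) : Split ⟨a, .and b c⟩ {⟨a, b⟩, ⟨a, c⟩}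
  | or (a b c) : Split ⟨.or a b, c⟩ {⟨a, c⟩, ⟨b, c⟩}

/-- Replacement of `p` by `θ` on both sides of an inequality. -/
def Ineq.subst [DecidableEq P] (p : P) (θ : MForm P N) (e : Ineq P N) : Ineq P N :=
  ⟨MForm.subst p θ e.lhs, MForm.subst p θ e.rhs⟩

/-- The rules of the preprocessing stage, rewriting one inequality into one or two. -/
inductive PreRule [DecidableEq P] [DecidableEq N] : Ineq P N → Finset (Ineq P N) → Prop
  | distrL (C : Ctx P N) (a b ψ) : Distr (C.holeSign .pos) a b →
      PreRule ⟨C.fill a, ψ⟩ {⟨C.fill b, ψ⟩}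
  | distrR (C : Ctx P N) (a b φ) : Distr (C.holeSign .neg) a b →
      PreRule ⟨φ, C.fill a⟩ {⟨φ, C.fill b⟩}
  | elimBot (p : P) (α β) : α.NegativeIn p → β.PositiveIn p →
      PreRule ⟨α, β⟩ {Ineq.subst p .bot ⟨α, β⟩}
  | elimTop (p : P) (α β) : α.NegativeIn p → β.PositiveIn p →
      PreRule ⟨β, α⟩ {Ineq.subst p .top ⟨β, α⟩}
  | split (e T) : Split e T → PreRule e T

/-- One step of the preprocessing stage. -/
inductive PreStep [DecidableEq P] [DecidableEq N] :
    Finset (Ineq P N) → Finset (Ineq P N) → Prop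
  | mk (T : Finset (Ineq P N)) (e T') : e ∈ T → PreRule e T' → PreStep T (T.erase e ∪ T')

/-- The residuation rules. -/
inductive Resid : Ineq P N → Ineq P N → Prop
  | dia (c d) : Resid ⟨.dia c, d⟩ ⟨c, .bbox d⟩
  | negLeft (c d) : Resid ⟨.neg c, d⟩ ⟨.neg d, c⟩
  | box (c d) : Resid ⟨c, .box d⟩ ⟨.bdia c, d⟩
  | negRight (c d) : Resid ⟨c, .neg d⟩ ⟨d, .neg c⟩
  | and₁ (c d b) : Resid ⟨.and c d, b⟩ ⟨c, .imp d b⟩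
  | or₁ (c d b) : Resid ⟨c, .or d b⟩ ⟨.and c (.neg d), b⟩
  | and₂ (c d b) : Resid ⟨.and c d, b⟩ ⟨d, .imp c b⟩
  | or₂ (c d b) : Resid ⟨c, .or d b⟩ ⟨.and c (.neg b), d⟩
  | imp₁ (c d b) : Resid ⟨c, .imp d b⟩ ⟨.and c d, b⟩
  | imp₂ (c d b) : Resid ⟨c, .imp d b⟩ ⟨d, .imp c b⟩

/-- The propositional variable `p` occurs in an inequality. -/
def Ineq.Occ (p : P) (e : Ineq P N) : Prop := e.lhs.Occ p ∨ e.rhs.Occ p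

/-- The nominal `i` occurs in an inequality. -/
def Ineq.NomOcc (i : N) (e : Ineq P N) : Prop := e.lhs.NomOcc i ∨ e.rhs.NomOcc i

/-- The nominal `i` occurs in a system. -/
def System.NomOcc (i : N) (s : System P N) : Prop :=
  (∃ e ∈ s.prem, e.NomOcc i) ∨ s.concl.NomOcc i

/-- One step of the reduction and elimination stage. -/
inductive RedStep [DecidableEq P] [DecidableEq N] : System P N → System P N → Prop
  | approxLeftPos (S : Finset (Ineq P N)) (C : Ctx P N) (γ ψ : MForm P N) (i : N) :
      C.IsSLR .pos → C.holeSign .pos = .pos → γ.IsBasic →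
      ¬ System.NomOcc i ⟨S, ⟨C.fill γ, ψ⟩⟩ →
      RedStep ⟨S, ⟨C.fill γ, ψ⟩⟩ ⟨S ∪ {⟨.nom i, γ⟩}, ⟨C.fill (.nom i), ψ⟩⟩
  | approxLeftNeg (S : Finset (Ineq P N)) (C : Ctx P N) (γ ψ : MForm P N) (i : N) :
      C.IsSLR .pos → C.holeSign .pos = .neg → γ.IsBasic →
      ¬ System.NomOcc i ⟨S, ⟨C.fill γ, ψ⟩⟩ →
      RedStep ⟨S, ⟨C.fill γ, ψ⟩⟩ ⟨S ∪ {⟨γ, .neg (.nom i)⟩}, ⟨C.fill (.neg (.nom i)), ψ⟩⟩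
  | approxRightPos (S : Finset (Ineq P N)) (C : Ctx P N) (γ φ : MForm P N) (i : N) :
      C.IsSLR .neg → C.holeSign .neg = .pos → γ.IsBasic →
      ¬ System.NomOcc i ⟨S, ⟨φ, C.fill γ⟩⟩ →
      RedStep ⟨S, ⟨φ, C.fill γ⟩⟩ ⟨S ∪ {⟨.nom i, γ⟩}, ⟨φ, C.fill (.nom i)⟩⟩
  | approxRightNeg (S : Finset (Ineq P N)) (C : Ctx P N) (γ φ : MForm P N) (i : N) :
      C.IsSLR .neg → C.holeSign .neg = .neg → γ.IsBasic →
      ¬ System.NomOcc i ⟨S, ⟨φ, C.fill γ⟩⟩ →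
      RedStep ⟨S, ⟨φ, C.fill γ⟩⟩ ⟨S ∪ {⟨γ, .neg (.nom i)⟩}, ⟨φ, C.fill (.neg (.nom i))⟩⟩
  | resid (S : Finset (Ineq P N)) (c e e' : Ineq P N) :
      e ∈ S → Resid e e' → RedStep ⟨S, c⟩ ⟨S.erase e ∪ {e'}, c⟩
  | split (S : Finset (Ineq P N)) (c e : Ineq P N) (T : Finset (Ineq P N)) :
      e ∈ S → Split e T → RedStep ⟨S, c⟩ ⟨S.erase e ∪ T, c⟩
  | rightAckermann (p : P) (αs : List (MForm P N)) (B : Finset (Ineq P N)) (c : Ineq P N) :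
      (∀ α ∈ αs, ¬ α.Occ p) → ¬ c.Occ p →
      (∀ e ∈ B, e.lhs.PositiveIn p ∧ e.rhs.NegativeIn p) →
      RedStep ⟨(αs.map fun α => Ineq.mk α (.prop p)).toFinset ∪ B, c⟩
        ⟨B.image (Ineq.subst p (MForm.bigOr αs)), c⟩
  | leftAckermann (p : P) (αs : List (MForm P N)) (B : Finset (Ineq P N)) (c : Ineq P N) :
      (∀ α ∈ αs, ¬ α.Occ p) → ¬ c.Occ p →
      (∀ e ∈ B, e.lhs.NegativeIn p ∧ e.rhs.PositiveIn p) →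
      RedStep ⟨(αs.map fun α => Ineq.mk (.prop p) α).toFinset ∪ B, c⟩
        ⟨B.image (Ineq.subst p (MForm.bigAnd αs)), c⟩

/-- A pure system, regarded as a system over the propositional variables `P`. -/
def System.ofPure [DecidableEq P] [DecidableEq N] (s : System Empty N) : System P N :=
  ⟨s.prem.image fun e => ⟨e.lhs.ofPure, e.rhs.ofPure⟩, ⟨s.concl.lhs.ofPure, s.concl.rhs.ofPure⟩⟩

/-- Some run of ALBA on `e` succeeds and outputs the first-order sentence `A`: preprocessing
rewrites `{e}` to the inequalities listed in `l`; from each of them, taken with an empty set of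
premises, the reduction stage reaches a pure system in the list `sys`; and `A` is the first-order
output of these pure systems. Runs need not apply preprocessing exhaustively or approximation
pivotally; runs that do are among those considered. -/
def Outputs [DecidableEq P] [DecidableEq N] (e : Ineq P N)
    (A : (corrLang Empty).Sentence) : Prop :=
  ∃ (l : List (Ineq P N)) (sys : List (System Empty N)),
    Relation.ReflTransGen PreStep {e} l.toFinset ∧
    List.Forall₂ (fun e' s => Relation.ReflTransGen RedStep ⟨∅, e'⟩ (System.ofPure s)) l sys ∧
    A = FO sys

end Algorithm

end PossALBA

namespace PossALBA

open FirstOrder FirstOrder.Language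

/-! ## Regular open sets -/

section RegularOpen

variable {W : Type w} [PartialOrder W]

/-! Every step of a run preserves and reflects validity on a full frame, where validity quantifies
over all models in the sense of `IsModel`; a pure system is then valid exactly when its first-order
translation is true.

The semantic basis is `sat_isRO`: on a full frame every truth set is regular open. Hence a formula
that holds densely below a point holds there, and one that fails at a point has its negation forced
at some refinement (`exists_sat_neg`). So the connectives obey the laws of a Boolean algebra with
operators, and the truth set of any formula is a legitimate value for a propositional variable. This
yields the equivalences behind distribution, splitting and residuation (`sat_distr`, `holds_split`,
`holds_resid`).

Variable elimination and the Ackermann rules read substitution as a change of valuation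
(`holds_subst`) and compare the two valuations by sign-directed monotonicity (`imp_sat_of_subset`).

Approximation rests on the fact that a regular open set is the union of the sets `ro {x}` for its
points `x`. SLR branches transport such a decomposition from the placeholder to the root
(`detects_fill`), so it is enough to let a fresh nominal range over the `ro {w}` that satisfy the
new premise.

At the end no propositional variables remain. A nominal takes only values `ro {w}`, which are
definable from `w` (`mem_ro_singleton`), so quantifying over nominals becomes quantifying over
points (`realize_ST`, `validSystem_ofPure`). -/

theorem mem_int_cl {X : Set W} {x : W} : x ∈ int (cl X) ↔ ∀ y ≤ x, ∃ z ≤ y, z ∈ X := Iff.rfl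

/-- A set is regular open iff it is a downset that contains every point below which it is dense. -/
theorem isRO_iff {X : Set W} :
    IsRO X ↔ (∀ x ∈ X, ∀ y ≤ x, y ∈ X) ∧ ∀ x, (∀ y ≤ x, ∃ z ≤ y, z ∈ X) → x ∈ X := by
  constructor
  · intro h
    refine ⟨fun x hx y hy => ?_, fun x hx => ?_⟩
    · rw [← h, mem_int_cl] at hx ⊢
      exact fun z hz => hx z (hz.trans hy)
    · rwa [← h, mem_int_cl]
  · rintro ⟨h₁, h₂⟩
    ext x
    exact ⟨h₂ x, fun hx y hy => ⟨y, le_rfl, h₁ x hx y hy⟩⟩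

theorem isRO_int_cl (X : Set W) : IsRO (int (cl X)) := by
  refine isRO_iff.2 ⟨fun x hx y hy z hz => hx z (hz.trans hy), fun x hx y hy => ?_⟩
  obtain ⟨z, hz, h⟩ := hx y hy
  obtain ⟨t, ht, h⟩ := h z le_rfl
  exact ⟨t, ht.trans hz, h⟩

theorem isRO_empty : IsRO (∅ : Set W) :=
  isRO_iff.2 ⟨by simp, fun x hx => by simpa using hx x le_rfl⟩

theorem isRO_univ : IsRO (Set.univ : Set W) := isRO_iff.2 ⟨by simp, by simp⟩

theorem IsRO.inter {X Y : Set W} (hX : IsRO X) (hY : IsRO Y) : IsRO (X ∩ Y) := by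
  rw [isRO_iff] at *
  refine ⟨fun x hx y hy => ⟨hX.1 x hx.1 y hy, hY.1 x hx.2 y hy⟩, fun x hx => ⟨?_, ?_⟩⟩
  · exact hX.2 x fun y hy => (hx y hy).imp fun z h => ⟨h.1, h.2.1⟩
  · exact hY.2 x fun y hy => (hx y hy).imp fun z h => ⟨h.1, h.2.2⟩

/-- The Heyting implication into a regular open set is regular open. -/
theorem IsRO.himp {X Y : Set W} (hX : IsRO X) (hY : IsRO Y) :
    IsRO {x | ∀ y ≤ x, y ∈ X → y ∈ Y} := by
  rw [isRO_iff] at *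
  refine ⟨fun x hx y hy z hz => hx z (hz.trans hy), fun x hx y hy hyX => hY.2 y fun z hz => ?_⟩
  obtain ⟨t, ht, h⟩ := hx z (hz.trans hy)
  exact ⟨t, ht, h t le_rfl (hX.1 y hyX t (ht.trans hz))⟩

theorem IsRO.compl {X : Set W} (hX : IsRO X) : IsRO {x | ∀ y ≤ x, y ∉ X} := by
  simpa using hX.himp isRO_empty

/-- Regular open sets are closed under arbitrary intersections, and `ro X` is such an intersection.
-/
theorem ro_isRO (X : Set W) : IsRO (ro X) := by
  refine isRO_iff.2 ⟨fun x hx y hy Z hZ => (isRO_iff.1 hZ.1).1 x (hx Z hZ) y hy,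
    fun x hx Z hZ => (isRO_iff.1 hZ.1).2 x fun y hy => ?_⟩
  obtain ⟨z, hz, h⟩ := hx y hy
  exact ⟨z, hz, h Z hZ⟩

theorem mem_ro_singleton_self (w : W) : w ∈ ro ({w} : Set W) := fun _ hZ => hZ.2 rfl

theorem ro_singleton_subset {X : Set W} (hX : IsRO X) {w : W} (hw : w ∈ X) : ro {w} ⊆ X :=
  fun _ hx => hx X ⟨hX, by simpa using hw⟩

/-- The closure `ro {w}` equals `int (cl (Set.Iic w))`. The bound `t` with `w = t` is kept so that
the right side has the shape of the translation of a nominal. -/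
theorem mem_ro_singleton {w x : W} :
    x ∈ ro ({w} : Set W) ↔ ∀ y ≤ x, ∃ z ≤ y, ∃ t, z ≤ t ∧ w = t := by
  constructor
  · intro h
    have := h (int (cl (Set.Iic w))) ⟨isRO_int_cl _, by
      rintro _ rfl y hy
      exact ⟨y, le_rfl, hy⟩⟩
    exact fun y hy => (this y hy).imp fun z hz => ⟨hz.1, w, hz.2, rfl⟩
  · refine fun h => (isRO_iff.1 (ro_isRO _)).2 x fun y hy => ?_
    obtain ⟨z, hz, t, ht, rfl⟩ := h y hy
    exact ⟨z, hz, (isRO_iff.1 (ro_isRO _)).1 _ (mem_ro_singleton_self _) z ht⟩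

end RegularOpen

/-! ## Satisfaction -/

namespace PossibilityFrame

variable {P : Type u} {N : Type v} {W : Type w} [PartialOrder W] {F : PossibilityFrame W}

/-- All propositional variables and all nominals are interpreted by regular open sets. -/
structure Regular (V : P → Set W) (U : N → Set W) : Prop where
  prop : ∀ p, IsRO (V p)
  nom : ∀ i, IsRO (U i)

/-! ### Regular openness of truth sets -/

theorem IsFull.box_isRO (hF : F.IsFull) {X : Set W} (hX : IsRO X) :
    IsRO {x | ∀ y, F.R x y → y ∈ X} := by
  have := F.box_mem X
  rw [hF] at this
  exact this hX

/-- The operator is the complement of the box of the complement, so closure under box suffices. -/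
theorem IsFull.dia_isRO (hF : F.IsFull) {X : Set W} (hX : IsRO X) :
    IsRO {x | ∀ y ≤ x, ∃ z, F.R y z ∧ ∃ t ≤ z, t ∈ X} := by
  simpa using (hF.box_isRO hX.compl).compl

theorem bdia_isRO (X : Set W) :
    IsRO {x | ∀ y ≤ x, ∃ z ≤ y, ∃ t, z ≤ t ∧ ∃ s, F.R s t ∧ s ∈ X} :=
  isRO_int_cl {z | ∃ t, z ≤ t ∧ ∃ s, F.R s t ∧ s ∈ X}

/-- If `y' ≤ y`, every point above `y` is above `y'`, so the condition imposed at `y'` already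
covers `y`. This works for an arbitrary `X`. -/
theorem bbox_isRO (X : Set W) :
    IsRO {x | ∀ y ≤ x, ∀ z, y ≤ z → ∀ t, F.R t z → ∃ s ≤ t, s ∈ X} := by
  refine isRO_iff.2 ⟨fun x hx y hy z hz => hx z (hz.trans hy), fun x hx y hy z hz t ht => ?_⟩
  obtain ⟨y', hy', h⟩ := hx y hy
  exact h y' le_rfl z (hy'.trans hz) t ht

section Sat

variable {V : P → Set W} {U : N → Set W}

/-- Fullness is needed here only for `□` and `◇`; the Boolean cases are operations on regular open
sets, and the two black connectives are regular open by the form of their clauses. -/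
theorem sat_isRO (hF : F.IsFull) (h : Regular V U) (φ : MForm P N) :
    IsRO {x | F.Sat V U x φ} := by
  induction φ with
  | prop p => exact h.prop p
  | nom i => exact h.nom i
  | top => exact isRO_univ
  | bot => exact isRO_empty
  | neg a iha => exact iha.compl
  | and a b iha ihb => exact iha.inter ihb
  | or a b iha ihb => exact isRO_int_cl {x | F.Sat V U x a ∨ F.Sat V U x b}
  | imp a b iha ihb => exact iha.himp ihb
  | box a iha => exact hF.box_isRO iha
  | dia a iha => exact hF.dia_isRO iha
  | bdia a iha => exact bdia_isRO _
  | bbox a iha => exact bbox_isRO _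

theorem sat_of_le (hF : F.IsFull) (h : Regular V U) {φ : MForm P N} {x y : W}
    (hx : F.Sat V U x φ) (hy : y ≤ x) : F.Sat V U y φ :=
  (isRO_iff.1 (sat_isRO hF h φ)).1 x hx y hy

theorem sat_of_dense (hF : F.IsFull) (h : Regular V U) {φ : MForm P N} {x : W}
    (hx : ∀ y ≤ x, ∃ z ≤ y, F.Sat V U z φ) : F.Sat V U x φ :=
  (isRO_iff.1 (sat_isRO hF h φ)).2 x hx

/-- The contrapositive of density. It turns mere failure at a point into failure at all refinements
of some refinement, the substitute for classical case distinction at a point. -/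
theorem exists_sat_neg (hF : F.IsFull) (h : Regular V U) {φ : MForm P N} {x : W}
    (hx : ¬ F.Sat V U x φ) : ∃ y ≤ x, F.Sat V U y (.neg φ) := by
  contrapose! hx
  refine sat_of_dense hF h fun y hy => ?_
  have := hx y hy
  simp only [Sat] at this
  push Not at this
  exact this

theorem sat_neg_neg (hF : F.IsFull) (h : Regular V U) {φ : MForm P N} {x : W} :
    F.Sat V U x (.neg (.neg φ)) ↔ F.Sat V U x φ := by
  refine ⟨fun hx => ?_, fun hx y hy hn => hn y le_rfl (sat_of_le hF h hx hy)⟩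
  by_contra hn
  obtain ⟨y, hy, h'⟩ := exists_sat_neg hF h hn
  exact hx y hy h'

theorem sat_or_of_left (hF : F.IsFull) (h : Regular V U) {a : MForm P N} (b : MForm P N) {x : W}
    (hx : F.Sat V U x a) : F.Sat V U x (.or a b) :=
  fun y hy => ⟨y, le_rfl, .inl (sat_of_le hF h hx hy)⟩

theorem sat_or_of_right (hF : F.IsFull) (h : Regular V U) (a : MForm P N) {b : MForm P N} {x : W}
    (hx : F.Sat V U x b) : F.Sat V U x (.or a b) :=
  fun y hy => ⟨y, le_rfl, .inr (sat_of_le hF h hx hy)⟩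

theorem sat_or_elim (hF : F.IsFull) (h : Regular V U) {a b c : MForm P N} {x : W}
    (hx : F.Sat V U x (.or a b)) (ha : ∀ y ≤ x, F.Sat V U y a → F.Sat V U y c)
    (hb : ∀ y ≤ x, F.Sat V U y b → F.Sat V U y c) : F.Sat V U x c := by
  refine sat_of_dense hF h fun y hy => ?_
  obtain ⟨z, hz, h'⟩ := hx y hy
  exact ⟨z, hz, h'.elim (ha z (hz.trans hy)) (hb z (hz.trans hy))⟩

/-- Truth of an inequality at all points of a model. -/
def Holds (F : PossibilityFrame W) (V : P → Set W) (U : N → Set W) (e : Ineq P N) : Prop :=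
  ∀ x, F.Sat V U x e.lhs → F.Sat V U x e.rhs

theorem holds_iff_of_sat_iff {a b c d : MForm P N} (hac : ∀ x, F.Sat V U x a ↔ F.Sat V U x c)
    (hbd : ∀ x, F.Sat V U x b ↔ F.Sat V U x d) : F.Holds V U ⟨a, b⟩ ↔ F.Holds V U ⟨c, d⟩ :=
  forall_congr' fun x => imp_congr (hac x) (hbd x)

/-! ### Finite joins and meets -/

theorem sat_bigOr (hF : F.IsFull) (h : Regular V U) {l : List (MForm P N)} {a : MForm P N}
    (ha : a ∈ l) {x : W} (hx : F.Sat V U x a) : F.Sat V U x (.bigOr l) := by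
  induction l using MForm.bigOr.induct with
  | case1 => simp at ha
  | case2 b =>
    obtain rfl := List.mem_singleton.1 ha
    exact hx
  | case3 b c l ih =>
    rcases List.mem_cons.1 ha with rfl | ha
    · exact sat_or_of_left hF h _ hx
    · exact sat_or_of_right hF h _ (ih ha)

theorem holds_bigOr (hF : F.IsFull) (h : Regular V U) {l : List (MForm P N)} {b : MForm P N}
    (hl : ∀ a ∈ l, F.Holds V U ⟨a, b⟩) : F.Holds V U ⟨.bigOr l, b⟩ := by
  induction l using MForm.bigOr.induct with
  | case1 => exact fun x hx => hx.elim
  | case2 a => exact hl a (by simp)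
  | case3 a c l ih =>
    exact fun x hx => sat_or_elim hF h hx (fun y _ => hl a (by simp) y)
      fun y _ => ih (fun a ha => hl a (List.mem_cons_of_mem _ ha)) y

theorem sat_bigAnd {l : List (MForm P N)} {x : W} :
    F.Sat V U x (.bigAnd l) ↔ ∀ a ∈ l, F.Sat V U x a := by
  induction l using MForm.bigAnd.induct with
  | case1 => simp [MForm.bigAnd, Sat]
  | case2 a => simp [MForm.bigAnd]
  | case3 a b l ih =>
    rw [MForm.bigAnd, Sat, ih]
    simp

end Sat

/-! ### Dependence on the valuation -/

theorem sat_congr {V V' : P → Set W} {U U' : N → Set W} {φ : MForm P N}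
    (hV : ∀ p, φ.Occ p → V p = V' p) (hU : ∀ i, φ.NomOcc i → U i = U' i) (x : W) :
    F.Sat V U x φ ↔ F.Sat V' U' x φ := by
  induction φ generalizing x with
  | prop p => simp only [Sat, hV p rfl]
  | nom i => simp only [Sat, hU i rfl]
  | top => simp only [Sat]
  | bot => simp only [Sat]
  | neg a iha => simp only [Sat, iha hV hU]
  | box a iha => simp only [Sat, iha hV hU]
  | dia a iha => simp only [Sat, iha hV hU]
  | bdia a iha => simp only [Sat, iha hV hU]
  | bbox a iha => simp only [Sat, iha hV hU]
  | and a b iha ihb =>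
    simp only [Sat, iha (fun p h => hV p (.inl h)) (fun i h => hU i (.inl h)),
      ihb (fun p h => hV p (.inr h)) (fun i h => hU i (.inr h))]
  | or a b iha ihb =>
    simp only [Sat, iha (fun p h => hV p (.inl h)) (fun i h => hU i (.inl h)),
      ihb (fun p h => hV p (.inr h)) (fun i h => hU i (.inr h))]
  | imp a b iha ihb =>
    simp only [Sat, iha (fun p h => hV p (.inl h)) (fun i h => hU i (.inl h)),
      ihb (fun p h => hV p (.inr h)) (fun i h => hU i (.inr h))]

theorem sat_update_prop [DecidableEq P] {V : P → Set W} {U : N → Set W} {p : P} {φ : MForm P N}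
    (h : ¬ φ.Occ p) (X : Set W) (x : W) :
    F.Sat (Function.update V p X) U x φ ↔ F.Sat V U x φ :=
  sat_congr (fun q hq => by
    rw [Function.update_of_ne]
    rintro rfl
    exact h hq) (fun _ _ => rfl) x

theorem sat_update_nom [DecidableEq N] {V : P → Set W} {U : N → Set W} {i : N} {φ : MForm P N}
    (h : ¬ φ.NomOcc i) (X : Set W) (x : W) :
    F.Sat V (Function.update U i X) x φ ↔ F.Sat V U x φ :=
  sat_congr (fun _ _ => rfl) (fun j hj => by
    rw [Function.update_of_ne]
    rintro rfl
    exact h hj) x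

theorem sat_subst [DecidableEq P] {V : P → Set W} {U : N → Set W} (p : P) (θ φ : MForm P N)
    (x : W) : F.Sat V U x (MForm.subst p θ φ) ↔
      F.Sat (Function.update V p {y | F.Sat V U y θ}) U x φ := by
  induction φ generalizing x with
  | prop q =>
    by_cases h : q = p
    · subst h
      simp [MForm.subst, Sat]
    · simp [MForm.subst, Sat, h]
  | _ => simp_all only [MForm.subst, Sat]

theorem holds_subst [DecidableEq P] {V : P → Set W} {U : N → Set W} (p : P) (θ : MForm P N)
    (e : Ineq P N) : F.Holds V U (e.subst p θ) ↔
      F.Holds (Function.update V p {y | F.Sat V U y θ}) U e :=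
  forall_congr' fun x => imp_congr (sat_subst p θ e.lhs x) (sat_subst p θ e.rhs x)

theorem holds_update_prop [DecidableEq P] {V : P → Set W} {U : N → Set W} {p : P} {e : Ineq P N}
    (h : ¬ e.Occ p) (X : Set W) : F.Holds (Function.update V p X) U e ↔ F.Holds V U e :=
  forall_congr' fun x => imp_congr (sat_update_prop (fun h' => h (.inl h')) X x)
    (sat_update_prop (fun h' => h (.inr h')) X x)

theorem holds_update_nom [DecidableEq N] {V : P → Set W} {U : N → Set W} {i : N} {e : Ineq P N}
    (h : ¬ e.NomOcc i) (X : Set W) : F.Holds V (Function.update U i X) e ↔ F.Holds V U e :=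
  forall_congr' fun x => imp_congr (sat_update_nom (fun h' => h (.inl h')) X x)
    (sat_update_nom (fun h' => h (.inr h')) X x)

end PossibilityFrame

/-! ### Monotonicity -/

/-- Implication in the direction given by a sign. -/
def Sign.Imp : Sign → Prop → Prop → Prop
  | .pos, a, b => a → b
  | .neg, a, b => b → a

theorem Sign.Imp.refl (r : Sign) (a : Prop) : r.Imp a a := by
  cases r <;> exact id

namespace PossibilityFrame

variable {P : Type u} {N : Type v} {W : Type w} [PartialOrder W] {F : PossibilityFrame W}

section Imp

variable {V V' : P → Set W} {U U' : N → Set W} {a a' b b' : MForm P N} {r : Sign}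

/-- Here and for the other connectives both the formula and the valuation may change, so that one
set of lemmas serves replacement in a context (`imp_sat_fill`) and enlargement of a variable
(`imp_sat_of_subset`). -/
theorem imp_sat_neg (ha : ∀ x, r.flip.Imp (F.Sat V U x a) (F.Sat V' U' x a')) (x : W) :
    r.Imp (F.Sat V U x (.neg a)) (F.Sat V' U' x (.neg a')) := by
  cases r <;> simp only [Sign.flip, Sign.Imp, Sat] at * <;> grind

theorem imp_sat_and (ha : ∀ x, r.Imp (F.Sat V U x a) (F.Sat V' U' x a'))
    (hb : ∀ x, r.Imp (F.Sat V U x b) (F.Sat V' U' x b')) (x : W) :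
    r.Imp (F.Sat V U x (.and a b)) (F.Sat V' U' x (.and a' b')) := by
  cases r <;> simp only [Sign.Imp, Sat] at * <;> grind

theorem imp_sat_or (ha : ∀ x, r.Imp (F.Sat V U x a) (F.Sat V' U' x a'))
    (hb : ∀ x, r.Imp (F.Sat V U x b) (F.Sat V' U' x b')) (x : W) :
    r.Imp (F.Sat V U x (.or a b)) (F.Sat V' U' x (.or a' b')) := by
  cases r <;> simp only [Sign.Imp, Sat] at * <;> grind

theorem imp_sat_imp (ha : ∀ x, r.flip.Imp (F.Sat V U x a) (F.Sat V' U' x a'))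
    (hb : ∀ x, r.Imp (F.Sat V U x b) (F.Sat V' U' x b')) (x : W) :
    r.Imp (F.Sat V U x (.imp a b)) (F.Sat V' U' x (.imp a' b')) := by
  cases r <;> simp only [Sign.flip, Sign.Imp, Sat] at * <;> grind

theorem imp_sat_box (ha : ∀ x, r.Imp (F.Sat V U x a) (F.Sat V' U' x a')) (x : W) :
    r.Imp (F.Sat V U x (.box a)) (F.Sat V' U' x (.box a')) := by
  cases r <;> simp only [Sign.Imp, Sat] at * <;> grind

theorem imp_sat_dia (ha : ∀ x, r.Imp (F.Sat V U x a) (F.Sat V' U' x a')) (x : W) :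
    r.Imp (F.Sat V U x (.dia a)) (F.Sat V' U' x (.dia a')) := by
  cases r <;> simp only [Sign.Imp, Sat] at * <;> grind

theorem imp_sat_bdia (ha : ∀ x, r.Imp (F.Sat V U x a) (F.Sat V' U' x a')) (x : W) :
    r.Imp (F.Sat V U x (.bdia a)) (F.Sat V' U' x (.bdia a')) := by
  cases r <;> simp only [Sign.Imp, Sat] at * <;> grind

theorem imp_sat_bbox (ha : ∀ x, r.Imp (F.Sat V U x a) (F.Sat V' U' x a')) (x : W) :
    r.Imp (F.Sat V U x (.bbox a)) (F.Sat V' U' x (.bbox a')) := by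
  cases r <;> simp only [Sign.Imp, Sat] at * <;> grind

/-- A formula in context is monotone or antitone in the filler, according to the sign. -/
theorem imp_sat_fill (C : Ctx P N)
    (h : ∀ x, (C.holeSign r).Imp (F.Sat V U x a) (F.Sat V U x b)) (x : W) :
    r.Imp (F.Sat V U x (C.fill a)) (F.Sat V U x (C.fill b)) := by
  induction C generalizing r x with
  | hole => exact h x
  | neg C ih => exact imp_sat_neg (ih h) x
  | andL C c ih => exact imp_sat_and (ih h) (fun _ => .refl _ _) x
  | andR c C ih => exact imp_sat_and (fun _ => .refl _ _) (ih h) x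
  | orL C c ih => exact imp_sat_or (ih h) (fun _ => .refl _ _) x
  | orR c C ih => exact imp_sat_or (fun _ => .refl _ _) (ih h) x
  | impL C c ih => exact imp_sat_imp (ih h) (fun _ => .refl _ _) x
  | impR c C ih => exact imp_sat_imp (fun _ => .refl _ _) (ih h) x
  | box C ih => exact imp_sat_box (ih h) x
  | dia C ih => exact imp_sat_dia (ih h) x

theorem sat_fill_congr (C : Ctx P N) (h : ∀ x, F.Sat V U x a ↔ F.Sat V U x b) (x : W) :
    F.Sat V U x (C.fill a) ↔ F.Sat V U x (C.fill b) := by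
  have key (s : Sign) : ∀ x, s.Imp (F.Sat V U x a) (F.Sat V U x b) := by
    cases s
    · exact fun x => (h x).1
    · exact fun x => (h x).2
  exact ⟨imp_sat_fill (r := .pos) C (key _) x, imp_sat_fill (r := .neg) C (key _) x⟩

/-- Increasing the value of `p` increases a formula in which `p` is never signed `-`. -/
theorem imp_sat_of_subset {p : P} (hp : V p ⊆ V' p) (hne : ∀ q ≠ p, V q = V' q)
    {φ : MForm P N} (h : ¬ MForm.SignedOcc .neg p r φ) (x : W) :
    r.Imp (F.Sat V U x φ) (F.Sat V' U x φ) := by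
  induction φ generalizing r x with
  | prop q =>
    by_cases hq : q = p
    · subst hq
      cases r
      · exact fun hx => hp hx
      · exact absurd ⟨rfl, rfl⟩ h
    · simp only [Sat, hne q hq]
      exact .refl _ _
  | nom i => exact .refl _ _
  | top => exact .refl _ _
  | bot => exact .refl _ _
  | neg a iha => exact imp_sat_neg (iha h) x
  | box a iha => exact imp_sat_box (iha h) x
  | dia a iha => exact imp_sat_dia (iha h) x
  | bdia a iha => exact imp_sat_bdia (iha h) x
  | bbox a iha => exact imp_sat_bbox (iha h) x
  | and a b iha ihb => exact imp_sat_and (iha (h ∘ .inl)) (ihb (h ∘ .inr)) x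
  | or a b iha ihb => exact imp_sat_or (iha (h ∘ .inl)) (ihb (h ∘ .inr)) x
  | imp a b iha ihb => exact imp_sat_imp (iha (h ∘ .inl)) (ihb (h ∘ .inr)) x

end Imp

/-- Lets `imp_sat_of_subset`, stated for the absence of leaves signed `-`, also handle negative
formulas: a negative `φ` has no such leaf once its root is signed `-`. -/
theorem signedOcc_flip (s : Sign) (p : P) (r : Sign) (φ : MForm P N) :
    MForm.SignedOcc s.flip p r.flip φ ↔ MForm.SignedOcc s p r φ := by
  induction φ generalizing r with
  | prop q => cases r <;> cases s <;> simp [MForm.SignedOcc, Sign.flip]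
  | _ => simp_all only [MForm.SignedOcc]

section Update

variable [DecidableEq P] {V : P → Set W} {U : N → Set W} {p : P} {φ : MForm P N}

theorem sat_of_positiveIn (h : φ.PositiveIn p) {X : Set W} (hX : V p ⊆ X) {x : W}
    (hx : F.Sat V U x φ) : F.Sat (Function.update V p X) U x φ :=
  imp_sat_of_subset (r := .pos) (by simpa using hX)
    (fun q hq => by simp [hq]) h x hx

theorem sat_of_positiveIn' (h : φ.PositiveIn p) {X : Set W} (hX : X ⊆ V p) {x : W}
    (hx : F.Sat (Function.update V p X) U x φ) : F.Sat V U x φ :=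
  imp_sat_of_subset (r := .pos) (p := p) (by simpa using hX)
    (fun q hq => by simp [hq]) h x hx

theorem sat_of_negativeIn (h : φ.NegativeIn p) {X : Set W} (hX : X ⊆ V p) {x : W}
    (hx : F.Sat V U x φ) : F.Sat (Function.update V p X) U x φ :=
  imp_sat_of_subset (r := .neg) (p := p) (by simpa using hX)
    (fun q hq => by simp [hq]) (fun h' => h ((signedOcc_flip .pos p .pos φ).1 h')) x hx

theorem sat_of_negativeIn' (h : φ.NegativeIn p) {X : Set W} (hX : V p ⊆ X) {x : W}
    (hx : F.Sat (Function.update V p X) U x φ) : F.Sat V U x φ :=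
  imp_sat_of_subset (r := .neg) (p := p) (by simpa using hX)
    (fun q hq => by simp [hq]) (fun h' => h ((signedOcc_flip .pos p .pos φ).1 h')) x hx

end Update

/-! ### Equivalences behind the rules -/

section Rules

variable {V : P → Set W} {U : N → Set W}

/-- Each distribution law is a true equivalence of regular open sets, whatever the sign of the node;
the signs only restrict where the algorithm uses it. -/
theorem sat_distr (hF : F.IsFull) (h : Regular V U) {s : Sign} {a b : MForm P N}
    (hab : Distr s a b) (x : W) : F.Sat V U x a ↔ F.Sat V U x b := by
  have le {φ : MForm P N} {x y : W} (hx : F.Sat V U x φ) (hy : y ≤ x) : F.Sat V U y φ :=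
    sat_of_le hF h hx hy
  have dense {φ : MForm P N} {x : W} (hx : ∀ y ≤ x, ∃ z ≤ y, F.Sat V U z φ) : F.Sat V U x φ :=
    sat_of_dense hF h hx
  have inl {a b : MForm P N} {x : W} (hx : F.Sat V U x a) : F.Sat V U x (.or a b) :=
    sat_or_of_left hF h b hx
  have inr {a b : MForm P N} {x : W} (hx : F.Sat V U x b) : F.Sat V U x (.or a b) :=
    sat_or_of_right hF h a hx
  have elim {a b c : MForm P N} {x : W} (hx : F.Sat V U x (.or a b))
      (ha : ∀ y ≤ x, F.Sat V U y a → F.Sat V U y c)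
      (hb : ∀ y ≤ x, F.Sat V U y b → F.Sat V U y c) : F.Sat V U x c :=
    sat_or_elim hF h hx ha hb
  induction hab with
  | dia a b =>
    constructor
    · intro hx
      by_contra hn
      obtain ⟨y, hy, h'⟩ := exists_sat_neg hF h hn
      have ha : ∀ z ≤ y, ¬ F.Sat V U z (.dia a) := fun z hz ha => h' z hz (inl ha)
      have hb : ∀ z ≤ y, ¬ F.Sat V U z (.dia b) := fun z hz hb => h' z hz (inr hb)
      -- Were `□¬c` to fail at `y`, some refinement would force its negation, which says `◇c`. With
      -- this, `y` forces both `□¬a` and `□¬b`, against `◇(a ∨ b)`.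
      have box {c : MForm P N} {y : W} (hc : ∀ z ≤ y, ¬ F.Sat V U z (.dia c)) :
          F.Sat V U y (.box (.neg c)) := by
        by_contra hn
        obtain ⟨z, hz, h'⟩ := exists_sat_neg hF h hn
        refine hc z hz fun t ht => ?_
        have := h' t ht
        simp only [Sat] at this
        push Not at this
        exact this
      obtain ⟨z, hz, t, ht, hab⟩ := hx y hy
      obtain ⟨s, hs, hab⟩ := hab t le_rfl
      exact hab.elim (box ha z hz s (hs.trans ht)) (box hb z hz s (hs.trans ht))
    · refine fun hx => elim hx (fun y _ => ?_) fun y _ => ?_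
      · exact imp_sat_dia (r := .pos) (fun _ => inl) y
      · exact imp_sat_dia (r := .pos) (fun _ => inr) y
  | andL a b c =>
    constructor
    · rintro ⟨hx, hc⟩
      exact elim hx (fun y hy ha => inl ⟨ha, le hc hy⟩) fun y hy hb => inr ⟨hb, le hc hy⟩
    · exact fun hx => elim hx (fun y hy ha => ⟨inl ha.1, ha.2⟩) fun y hy hb => ⟨inr hb.1, hb.2⟩
  | andR a b c =>
    constructor
    · rintro ⟨hc, hx⟩
      exact elim hx (fun y hy ha => inl ⟨le hc hy, ha⟩) fun y hy hb => inr ⟨le hc hy, hb⟩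
    · exact fun hx => elim hx (fun y hy ha => ⟨ha.1, inl ha.2⟩) fun y hy hb => ⟨hb.1, inr hb.2⟩
  | negOr a b =>
    refine ⟨fun hx => ⟨fun y hy ha => hx y hy (inl ha), fun y hy hb => hx y hy (inr hb)⟩, ?_⟩
    rintro ⟨ha, hb⟩ y hy hab
    obtain ⟨z, hz, h'⟩ := hab y le_rfl
    exact h'.elim (ha z (hz.trans hy)) (hb z (hz.trans hy))
  | impL a b c =>
    refine ⟨fun hx => ⟨fun y hy ha => hx y hy (inl ha), fun y hy hb => hx y hy (inr hb)⟩, ?_⟩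
    rintro ⟨ha, hb⟩ y hy hab
    exact elim hab (fun z hz => ha z (hz.trans hy)) fun z hz => hb z (hz.trans hy)
  | box a b => exact ⟨fun hx => ⟨fun y hy => (hx y hy).1, fun y hy => (hx y hy).2⟩,
      fun hx y hy => ⟨hx.1 y hy, hx.2 y hy⟩⟩
  | orL a b c =>
    constructor
    · exact fun hx => elim hx (fun y _ hy => ⟨inl hy.1, inl hy.2⟩) fun y _ hy => ⟨inr hy, inr hy⟩
    · rintro ⟨ha, hb⟩
      exact elim ha (fun y hy ha => elim (le hb hy) (fun z hz hb => inl ⟨le ha hz, hb⟩)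
        fun z hz => inr) fun y hy => inr
  | orR a b c =>
    constructor
    · exact fun hx => elim hx (fun y _ hy => ⟨inl hy, inl hy⟩) fun y _ hy => ⟨inr hy.1, inr hy.2⟩
    · rintro ⟨ha, hb⟩
      exact elim ha (fun y hy => inl) fun y hy ha => elim (le hb hy) (fun z hz => inl)
        fun z hz hb => inr ⟨le ha hz, hb⟩
  | negAnd a b =>
    constructor
    · intro hx y hy
      by_cases ha : F.Sat V U y a
      · exact ⟨y, le_rfl, .inr fun z hz hb => hx z (hz.trans hy) ⟨le ha hz, hb⟩⟩
      · obtain ⟨z, hz, h'⟩ := exists_sat_neg hF h ha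
        exact ⟨z, hz, .inl h'⟩
    · exact fun hx => elim hx (fun y _ ha z hz hab => ha z hz hab.1)
        fun y _ hb z hz hab => hb z hz hab.2
  | impR a b c => exact ⟨fun hx => ⟨fun y hy hc => (hx y hy hc).1, fun y hy hc => (hx y hy hc).2⟩,
      fun hx y hy hc => ⟨hx.1 y hy hc, hx.2 y hy hc⟩⟩

/-! ### Splitting and residuation -/

theorem holds_and_right {a b c : MForm P N} :
    F.Holds V U ⟨a, .and b c⟩ ↔ F.Holds V U ⟨a, b⟩ ∧ F.Holds V U ⟨a, c⟩ :=
  ⟨fun hx => ⟨fun x ha => (hx x ha).1, fun x ha => (hx x ha).2⟩,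
    fun hx x ha => ⟨hx.1 x ha, hx.2 x ha⟩⟩

theorem holds_or_left (hF : F.IsFull) (h : Regular V U) {a b c : MForm P N} :
    F.Holds V U ⟨.or a b, c⟩ ↔ F.Holds V U ⟨a, c⟩ ∧ F.Holds V U ⟨b, c⟩ :=
  ⟨fun hx => ⟨fun x ha => hx x (sat_or_of_left hF h b ha),
    fun x hb => hx x (sat_or_of_right hF h a hb)⟩,
    fun hx _ hab => sat_or_elim hF h hab (fun y _ => hx.1 y) fun y _ => hx.2 y⟩

theorem holds_split [DecidableEq P] [DecidableEq N] (hF : F.IsFull) (h : Regular V U)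
    {e : Ineq P N} {T : Finset (Ineq P N)} (hT : Split e T) :
    F.Holds V U e ↔ ∀ e' ∈ T, F.Holds V U e' := by
  cases hT with
  | and a b c => simpa using holds_and_right
  | or a b c => simpa using holds_or_left hF h

theorem holds_imp_right (hF : F.IsFull) (h : Regular V U) {a b c : MForm P N} :
    F.Holds V U ⟨a, .imp b c⟩ ↔ F.Holds V U ⟨.and a b, c⟩ :=
  ⟨fun hx x hab => hx x hab.1 x le_rfl hab.2,
    fun hx _ ha y hy hb => hx y ⟨sat_of_le hF h ha hy, hb⟩⟩

theorem holds_and_comm {a b c : MForm P N} :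
    F.Holds V U ⟨.and a b, c⟩ ↔ F.Holds V U ⟨.and b a, c⟩ :=
  holds_iff_of_sat_iff (fun _ => And.comm) fun _ => Iff.rfl

theorem holds_neg_right (hF : F.IsFull) (h : Regular V U) {a b : MForm P N} :
    F.Holds V U ⟨a, .neg b⟩ ↔ F.Holds V U ⟨.and a b, .bot⟩ :=
  -- The clauses for `¬b` and `b → ⊥` agree definitionally.
  holds_imp_right (c := .bot) hF h

theorem holds_neg_right_comm (hF : F.IsFull) (h : Regular V U) {a b : MForm P N} :
    F.Holds V U ⟨a, .neg b⟩ ↔ F.Holds V U ⟨b, .neg a⟩ := by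
  rw [holds_neg_right hF h, holds_neg_right hF h, holds_and_comm]

theorem holds_neg_neg (hF : F.IsFull) (h : Regular V U) {a b : MForm P N} :
    F.Holds V U ⟨.neg a, .neg b⟩ ↔ F.Holds V U ⟨b, a⟩ := by
  rw [holds_neg_right_comm hF h]
  exact holds_iff_of_sat_iff (fun _ => Iff.rfl) fun _ => sat_neg_neg hF h

theorem holds_neg_left (hF : F.IsFull) (h : Regular V U) {a b : MForm P N} :
    F.Holds V U ⟨.neg a, b⟩ ↔ F.Holds V U ⟨.neg b, a⟩ := by
  rw [← holds_neg_neg hF h]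
  exact holds_iff_of_sat_iff (fun _ => Iff.rfl) fun _ => sat_neg_neg hF h

theorem holds_or_right (hF : F.IsFull) (h : Regular V U) {a b c : MForm P N} :
    F.Holds V U ⟨a, .or b c⟩ ↔ F.Holds V U ⟨.and a (.neg b), c⟩ := by
  constructor
  · exact fun hx x hab => sat_or_elim hF h (hx x hab.1)
      (fun y hy hb => (hab.2 y hy hb).elim) fun _ _ => id
  · intro hx x ha y hy
    by_cases hb : F.Sat V U y b
    · exact ⟨y, le_rfl, .inl hb⟩
    · obtain ⟨z, hz, h'⟩ := exists_sat_neg hF h hb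
      exact ⟨z, hz, .inr (hx z ⟨sat_of_le hF h ha (hz.trans hy), h'⟩)⟩

theorem sat_or_comm {a b : MForm P N} {x : W} :
    F.Sat V U x (.or a b) ↔ F.Sat V U x (.or b a) := by
  simp only [Sat, or_comm]

/-- The adjunction between `◆` and `□`. A successor of a point of `a` lies in `◆a`; conversely `◆a`
is the regular open closure of the set of such successors, and regular openness of `b` absorbs the
closure. -/
theorem holds_box_right (hF : F.IsFull) (h : Regular V U) {a b : MForm P N} :
    F.Holds V U ⟨a, .box b⟩ ↔ F.Holds V U ⟨.bdia a, b⟩ := by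
  constructor
  · refine fun hx x ha => sat_of_dense hF h fun y hy => ?_
    obtain ⟨z, hz, t, ht, s, hs, h'⟩ := ha y hy
    exact ⟨z, hz, sat_of_le hF h (hx s h' t hs) ht⟩
  · exact fun hx x ha y hy => hx y fun z hz => ⟨z, le_rfl, y, hz, x, hy, ha⟩

/-- The dual adjunction, obtained from `holds_box_right` by contraposition through `◇ = ¬□¬` and `■
= ¬◆¬`. -/
theorem holds_dia_left (hF : F.IsFull) (h : Regular V U) {a b : MForm P N} :
    F.Holds V U ⟨.dia a, b⟩ ↔ F.Holds V U ⟨a, .bbox b⟩ := by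
  have dia (x : W) : F.Sat V U x (.dia a) ↔ F.Sat V U x (.neg (.box (.neg a))) := by
    simp [Sat]
  have bbox (x : W) : F.Sat V U x (.bbox b) ↔ F.Sat V U x (.neg (.bdia (.neg b))) := by
    constructor
    · intro hx y hy hn
      obtain ⟨z, hz, t, ht, s, hs, h'⟩ := hn y le_rfl
      obtain ⟨r, hr, hb⟩ := hx z (hz.trans hy) t ht s hs
      exact h' r hr hb
    · intro hx y hy z hz t ht
      by_contra! hn
      -- By `hn` the point `t` forces `¬b`, and each refinement of `y` is below its successor `z`;
      -- so `y` would force `◆¬b`.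
      exact hx y hy fun y' hy' => ⟨y', le_rfl, z, hy'.trans hz, t, ht, hn⟩
  rw [holds_iff_of_sat_iff dia fun _ => Iff.rfl, holds_iff_of_sat_iff (fun _ => Iff.rfl) bbox,
    holds_neg_left hF h, holds_box_right hF h, holds_neg_right_comm hF h]

theorem holds_resid (hF : F.IsFull) (h : Regular V U) {e e' : Ineq P N} (he : Resid e e') :
    F.Holds V U e ↔ F.Holds V U e' := by
  cases he with
  | dia c d => exact holds_dia_left hF h
  | negLeft c d => exact holds_neg_left hF h
  | box c d => exact holds_box_right hF h
  | negRight c d => exact holds_neg_right_comm hF h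
  | and₁ c d b => exact (holds_imp_right hF h).symm
  | or₁ c d b => exact holds_or_right hF h
  | and₂ c d b => exact holds_and_comm.trans (holds_imp_right hF h).symm
  | or₂ c d b =>
    exact (holds_iff_of_sat_iff (fun _ => Iff.rfl) fun _ => sat_or_comm).trans
      (holds_or_right hF h)
  | imp₁ c d b => exact holds_imp_right hF h
  | imp₂ c d b =>
    exact (holds_imp_right hF h).trans (holds_and_comm.trans (holds_imp_right hF h).symm)

end Rules

/-! ### Models and preservation of validity -/

/-- Propositional variables are interpreted by regular open sets, nominals by regular open
closures of singletons. -/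
structure IsModel (V : P → Set W) (U : N → Set W) : Prop where
  prop : ∀ p, IsRO (V p)
  nom : ∀ i, ∃ x, U i = ro {x}

namespace IsModel

variable {V : P → Set W} {U : N → Set W}

theorem regular (h : IsModel V U) : Regular V U where
  prop := h.prop
  nom i := by
    obtain ⟨x, hx⟩ := h.nom i
    exact hx ▸ ro_isRO _

theorem update_prop [DecidableEq P] (h : IsModel V U) (p : P) {X : Set W} (hX : IsRO X) :
    IsModel (Function.update V p X) U where
  prop q := by
    by_cases hq : q = p
    · subst hq
      simpa using hX
    · simpa [hq] using h.prop q
  nom := h.nom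

theorem update_nom [DecidableEq N] (h : IsModel V U) (i : N) (w : W) :
    IsModel V (Function.update U i (ro {w})) where
  prop := h.prop
  nom j := by
    by_cases hj : j = i
    · subst hj
      exact ⟨w, by simp⟩
    · simpa [hj] using h.nom j

end IsModel

/-! ### Soundness of preprocessing -/

theorem IsFull.valid_iff (hF : F.IsFull) {e : Ineq P N} :
    F.Valid e ↔ ∀ (V : P → Set W) (U : N → Set W), IsModel V U → F.Holds V U e := by
  rw [IsFull] at hF
  simp only [Valid, hF]
  exact ⟨fun h V U hM => h V U hM.prop hM.nom, fun h V U hV hU => h V U ⟨hV, hU⟩⟩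

theorem valid_preRule [DecidableEq P] [DecidableEq N] (hF : F.IsFull) {e : Ineq P N}
    {T : Finset (Ineq P N)} (hT : PreRule e T) : F.Valid e ↔ ∀ e' ∈ T, F.Valid e' := by
  cases hT with
  | distrL C a b ψ hab =>
    simp only [Finset.mem_singleton, forall_eq, hF.valid_iff]
    refine forall₃_congr fun V U h => holds_iff_of_sat_iff ?_ fun _ => Iff.rfl
    exact sat_fill_congr C (sat_distr hF h.regular hab)
  | distrR C a b φ hab =>
    simp only [Finset.mem_singleton, forall_eq, hF.valid_iff]
    refine forall₃_congr fun V U h => holds_iff_of_sat_iff (fun _ => Iff.rfl) ?_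
    exact sat_fill_congr C (sat_distr hF h.regular hab)
  | elimBot p α β hα hβ =>
    simp only [Finset.mem_singleton, forall_eq, hF.valid_iff, holds_subst]
    refine ⟨fun h V U hM => h _ U (hM.update_prop p (sat_isRO hF hM.regular .bot)),
      fun h V U hM x hx => ?_⟩
    -- Lowering `p` to the least value enlarges `α` and shrinks `β`, so the instance at `⊥` is the
    -- strongest one.
    have hs : {y | F.Sat V U y .bot} ⊆ V p := fun _ h => h.elim
    exact sat_of_positiveIn' hβ hs (h V U hM x (sat_of_negativeIn hα hs hx))
  | elimTop p α β hα hβ =>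
    simp only [Finset.mem_singleton, forall_eq, hF.valid_iff, holds_subst]
    refine ⟨fun h V U hM => h _ U (hM.update_prop p (sat_isRO hF hM.regular .top)),
      fun h V U hM x hx => ?_⟩
    have hs : V p ⊆ {y | F.Sat V U y .top} := fun _ _ => trivial
    exact sat_of_negativeIn' hα hs (h V U hM x (sat_of_positiveIn hβ hs hx))
  | split e T hT =>
    simp only [hF.valid_iff]
    exact ⟨fun h e' he V U hM => (holds_split hF hM.regular hT).1 (h V U hM) e' he,
      fun h V U hM => (holds_split hF hM.regular hT).2 fun e' he => h e' he V U hM⟩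

/-- The replaced element may itself reappear in `T`, or elements of `T` may already be in `S`;
neither affects the equivalence. -/
theorem forall_mem_erase_union {α : Type*} [DecidableEq α] {p : α → Prop} {S T : Finset α} {a : α}
    (ha : a ∈ S) (h : p a ↔ ∀ b ∈ T, p b) : (∀ b ∈ S, p b) ↔ ∀ b ∈ S.erase a ∪ T, p b := by
  simp only [Finset.mem_union, Finset.mem_erase]
  refine ⟨fun hS b hb => hb.elim (fun hb => hS b hb.2) (h.1 (hS a ha) b), fun hS b hb => ?_⟩
  by_cases hba : b = a
  · exact hba ▸ h.2 fun c hc => hS c (.inr hc)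
  · exact hS b (.inl ⟨hba, hb⟩)

theorem valid_preprocess [DecidableEq P] [DecidableEq N] (hF : F.IsFull)
    {T T' : Finset (Ineq P N)} (h : Relation.ReflTransGen PreStep T T') :
    (∀ e ∈ T, F.Valid e) ↔ ∀ e ∈ T', F.Valid e := by
  induction h with
  | refl => rfl
  | tail _ h ih =>
    cases h with
    | mk e T' he hT => exact ih.trans (forall_mem_erase_union he (valid_preRule hF hT))

/-- Validity of a system as a quasi-inequality. -/
def ValidSystem (F : PossibilityFrame W) (s : System P N) : Prop :=
  ∀ (V : P → Set W) (U : N → Set W), IsModel V U →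
    (∀ e ∈ s.prem, F.Holds V U e) → F.Holds V U s.concl

/-! ### Approximation -/

/-- `Detects F V U U' s a b`: for the sign `+`, below every point of `a` some `U' j` puts a point
into `b`; for the sign `-`, every point outside `a` is outside `b` under some `U' j`. -/
def Detects (F : PossibilityFrame W) (V : P → Set W) (U : N → Set W) {ι : Type*}
    (U' : ι → N → Set W) : Sign → MForm P N → MForm P N → Prop
  | .pos, a, b => ∀ x, F.Sat V U x a → ∃ j, ∃ y ≤ x, F.Sat V (U' j) y b
  | .neg, a, b => ∀ x, ¬ F.Sat V U x a → ∃ j, ¬ F.Sat V (U' j) x b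

/-- SLR branches are completely join preserving (root `+`) or completely meet preserving
(root `-`), so that detection passes from the placeholder to the root. -/
theorem detects_fill (hF : F.IsFull) {V : P → Set W} {U : N → Set W} {ι : Type*}
    {U' : ι → N → Set W} (h : Regular V U) (h' : ∀ j, Regular V (U' j)) {a b : MForm P N}
    (C : Ctx P N) {r : Sign} (hC : C.IsSLR r)
    (hU : ∀ i, (C.fill a).NomOcc i → ∀ j, U i = U' j i)
    (hab : Detects F V U U' (C.holeSign r) a b) :
    Detects F V U U' r (C.fill a) (C.fill b) := by
  -- Formulas beside the branch mention only nominals on which all the `U' j` agree with `U`, so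
  -- they keep their truth value.
  have side {c : MForm P N} (hc : ∀ i, c.NomOcc i → ∀ j, U i = U' j i) (j : ι) (x : W) :
      F.Sat V U x c ↔ F.Sat V (U' j) x c :=
    sat_congr (fun _ _ => rfl) (fun i hi => hc i hi j) x
  induction C generalizing r with
  | hole => exact hab
  | neg C ih =>
    cases r with
    | pos =>
      intro x hx
      obtain ⟨j, hj⟩ := ih hC hU hab x (hx x le_rfl)
      exact ⟨j, exists_sat_neg hF (h' j) hj⟩
    | neg =>
      intro x hx
      simp only [Ctx.fill, Sat] at hx
      push Not at hx
      obtain ⟨y, hy, hx⟩ := hx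
      obtain ⟨j, z, hz, hj⟩ := ih hC hU hab y hx
      exact ⟨j, fun hn => hn z (hz.trans hy) hj⟩
  | andL C c ih =>
    obtain ⟨rfl, hC⟩ := hC
    rintro x ⟨hx, hc⟩
    obtain ⟨j, y, hy, hj⟩ := ih hC (fun i hi => hU i (.inl hi)) hab x hx
    exact ⟨j, y, hy, hj, (side (fun i hi => hU i (.inr hi)) j y).1 (sat_of_le hF h hc hy)⟩
  | andR c C ih =>
    obtain ⟨rfl, hC⟩ := hC
    rintro x ⟨hc, hx⟩
    obtain ⟨j, y, hy, hj⟩ := ih hC (fun i hi => hU i (.inr hi)) hab x hx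
    exact ⟨j, y, hy, (side (fun i hi => hU i (.inl hi)) j y).1 (sat_of_le hF h hc hy), hj⟩
  | orL C c ih =>
    obtain ⟨rfl, hC⟩ := hC
    intro x hx
    simp only [Ctx.fill, Sat] at hx
    push Not at hx
    obtain ⟨y, hy, hx⟩ := hx
    obtain ⟨j, hj⟩ := ih hC (fun i hi => hU i (.inl hi)) hab y (hx y le_rfl).1
    obtain ⟨z, hz, hj⟩ := exists_sat_neg hF (h' j) hj
    refine ⟨j, fun hor => ?_⟩
    obtain ⟨t, ht, hor⟩ := hor z (hz.trans hy)
    exact hor.elim (hj t ht) fun hc =>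
      (hx t (ht.trans hz)).2 ((side (fun i hi => hU i (.inr hi)) j t).2 hc)
  | orR c C ih =>
    obtain ⟨rfl, hC⟩ := hC
    intro x hx
    simp only [Ctx.fill, Sat] at hx
    push Not at hx
    obtain ⟨y, hy, hx⟩ := hx
    obtain ⟨j, hj⟩ := ih hC (fun i hi => hU i (.inr hi)) hab y (hx y le_rfl).2
    obtain ⟨z, hz, hj⟩ := exists_sat_neg hF (h' j) hj
    refine ⟨j, fun hor => ?_⟩
    obtain ⟨t, ht, hor⟩ := hor z (hz.trans hy)
    exact hor.elim (fun hc =>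
      (hx t (ht.trans hz)).1 ((side (fun i hi => hU i (.inl hi)) j t).2 hc)) (hj t ht)
  | impL C c ih =>
    obtain ⟨rfl, hC⟩ := hC
    intro x hx
    simp only [Ctx.fill, Sat] at hx
    push Not at hx
    obtain ⟨y, hy, hx, hc⟩ := hx
    -- Detection yields only some point below the given one, so `c` must first be refuted at all
    -- refinements.
    obtain ⟨z, hz, hc⟩ := exists_sat_neg hF h hc
    obtain ⟨j, t, ht, hj⟩ := ih hC (fun i hi => hU i (.inl hi)) hab z (sat_of_le hF h hx hz)
    exact ⟨j, fun himp => hc t ht ((side (fun i hi => hU i (.inr hi)) j t).2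
      (himp t (ht.trans (hz.trans hy)) hj))⟩
  | impR c C ih =>
    obtain ⟨rfl, hC⟩ := hC
    intro x hx
    simp only [Ctx.fill, Sat] at hx
    push Not at hx
    obtain ⟨y, hy, hc, hx⟩ := hx
    obtain ⟨j, hj⟩ := ih hC (fun i hi => hU i (.inr hi)) hab y hx
    exact ⟨j, fun himp => hj (himp y hy ((side (fun i hi => hU i (.inl hi)) j y).1 hc))⟩
  | box C ih =>
    obtain ⟨rfl, hC⟩ := hC
    intro x hx
    simp only [Ctx.fill, Sat] at hx
    push Not at hx
    obtain ⟨y, hy, hx⟩ := hx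
    obtain ⟨j, hj⟩ := ih hC hU hab y hx
    exact ⟨j, fun hbox => hj (hbox y hy)⟩
  | dia C ih =>
    obtain ⟨rfl, hC⟩ := hC
    intro x hx
    obtain ⟨y, hy, z, hz, hx⟩ := hx x le_rfl
    obtain ⟨j, t, ht, hj⟩ := ih hC hU hab z hx
    -- The one successor found at `x` does not make `◇` true at `x`, since other refinements of `x`
    -- are unconstrained. It does refute `□¬`, and some refinement of `x` then forces `◇`.
    have hbox : ¬ F.Sat V (U' j) x (.box (.neg (C.fill b))) :=
      fun hn => hn y hy t (ht.trans hz) hj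
    obtain ⟨s, hs, hn⟩ := exists_sat_neg hF (h' j) hbox
    refine ⟨j, s, hs, fun q hq => ?_⟩
    have := hn q hq
    simp only [Sat] at this
    push Not at this
    exact this

section Approximation

/-- Detection at every refinement of `x` makes `ψ` dense below `x`, although the index `j` may vary
with the refinement. -/
theorem holds_left_of_detects (hF : F.IsFull) {V : P → Set W} {U : N → Set W} {ι : Type*}
    {U' : ι → N → Set W} (h : Regular V U) {a b ψ : MForm P N}
    (hψ : ∀ j x, F.Sat V (U' j) x ψ → F.Sat V U x ψ) (hab : Detects F V U U' .pos a b)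
    (hb : ∀ j, F.Holds V (U' j) ⟨b, ψ⟩) : F.Holds V U ⟨a, ψ⟩ := by
  refine fun x hx => sat_of_dense hF h fun y hy => ?_
  obtain ⟨j, z, hz, hj⟩ := hab y (sat_of_le hF h hx hy)
  exact ⟨z, hz, hψ j z (hb j z hj)⟩

theorem holds_right_of_detects {V : P → Set W} {U : N → Set W} {ι : Type*}
    {U' : ι → N → Set W} {a b φ : MForm P N}
    (hφ : ∀ j x, F.Sat V U x φ → F.Sat V (U' j) x φ) (hab : Detects F V U U' .neg a b)
    (hb : ∀ j, F.Holds V (U' j) ⟨φ, b⟩) : F.Holds V U ⟨φ, a⟩ := by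
  intro x hx
  by_contra hn
  obtain ⟨j, hj⟩ := hab x hn
  exact hj (hb j x (hφ j x hx))

/-- The approximating formula for a placeholder of the given sign. -/
def approximant (i : N) : Sign → MForm P N
  | .pos => .nom i
  | .neg => .neg (.nom i)

/-- The premise introduced by approximating `γ` at a placeholder of the given sign. -/
def approximation (i : N) (γ : MForm P N) : Sign → Ineq P N
  | .pos => ⟨.nom i, γ⟩
  | .neg => ⟨γ, .neg (.nom i)⟩

theorem imp_approximant {V : P → Set W} {U : N → Set W} {i : N} {γ : MForm P N} {s : Sign}
    (h : F.Holds V U (approximation i γ s)) (x : W) :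
    s.Imp (F.Sat V U x (approximant i s)) (F.Sat V U x γ) := by
  cases s <;> exact h x

/-- The index type consists of exactly the points whose closure, as value of `i`, satisfies the new
premise. For sign `+` a point of `γ` detects itself; for sign `-` a point outside `γ` is detected by
a refinement forcing `¬γ`. -/
theorem detects_approximant [DecidableEq N] (hF : F.IsFull) {V : P → Set W} {U : N → Set W} (h : IsModel V U)
    {i : N} {γ : MForm P N} (hi : ¬ γ.NomOcc i) (s : Sign) :
    Detects F V U
      (fun j : {w : W // F.Holds V (Function.update U i (ro {w})) (approximation i γ s)} =>
        Function.update U i (ro {j.1})) s γ (approximant i s) := by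
  have sat_nom (w x : W) :
      F.Sat V (Function.update U i (ro {w})) x (.nom i) ↔ x ∈ ro {w} := by
    simp [Sat]
  cases s with
  | pos =>
    refine fun x hx => ⟨⟨x, fun y hy => ?_⟩, x, le_rfl, ?_⟩
    · refine (sat_update_nom hi _ y).2 ?_
      exact ro_singleton_subset (sat_isRO hF h.regular γ) hx ((sat_nom x y).1 hy)
    · exact (sat_nom x x).2 (mem_ro_singleton_self x)
  | neg =>
    intro x hx
    obtain ⟨y, hy, hn⟩ := exists_sat_neg hF h.regular hx
    refine ⟨⟨y, ?_⟩, fun h' => h' y hy ((sat_nom y y).2 (mem_ro_singleton_self y))⟩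
    -- The premise `γ ≤ ¬i` is rewritten as `i ≤ ¬γ`, which holds because `¬γ` is regular open and
    -- contains `y`.
    refine (holds_neg_right_comm hF (h.update_nom i y).regular).2 fun z hz => ?_
    refine (sat_update_nom (φ := .neg γ) hi _ z).2 ?_
    exact ro_singleton_subset (sat_isRO hF h.regular (.neg γ)) hn ((sat_nom y z).1 hz)

theorem nomOcc_of_nomOcc_fill {i : N} {C : Ctx P N} {γ : MForm P N} (h : γ.NomOcc i) :
    (C.fill γ).NomOcc i := by
  induction C with
  | hole => exact h
  | andL C b ih | orL C b ih | impL C b ih => exact .inl ih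
  | andR a C ih | orR a C ih | impR a C ih => exact .inr ih
  | neg C ih | box C ih | dia C ih => exact ih

variable [DecidableEq P] [DecidableEq N]

/-- Forwards, the new premise puts the approximated left side below the original one in the same
model. Backwards, freshness allows `i` to be reinterpreted at every admissible point without
disturbing `S`, `ψ` or the side formulas, and detection recombines the results. -/
theorem validSystem_approx_left (hF : F.IsFull) {S : Finset (Ineq P N)} {C : Ctx P N}
    {γ ψ : MForm P N} {i : N} (hC : C.IsSLR .pos)
    (hi : ¬ System.NomOcc i ⟨S, ⟨C.fill γ, ψ⟩⟩) :
    F.ValidSystem ⟨S, ⟨C.fill γ, ψ⟩⟩ ↔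
      F.ValidSystem ⟨S ∪ {approximation i γ (C.holeSign .pos)},
        ⟨C.fill (approximant i (C.holeSign .pos)), ψ⟩⟩ := by
  simp only [System.NomOcc, Ineq.NomOcc, not_or, not_exists, not_and] at hi
  obtain ⟨hS, hφ, hψ⟩ := hi
  constructor
  · intro h V U hM hprem x hx
    simp only [Finset.mem_union, Finset.mem_singleton] at hprem
    refine h V U hM (fun e he => hprem e (.inl he)) x ?_
    exact imp_sat_fill (r := .pos) C (imp_approximant (hprem _ (.inr rfl))) x hx
  · intro h V U hM hprem
    refine holds_left_of_detects hF hM.regular (fun j x => (sat_update_nom hψ _ x).1)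
      (detects_fill hF hM.regular ?_ C hC ?_
        (detects_approximant hF hM (fun h => hφ (nomOcc_of_nomOcc_fill h)) _)) ?_
    · exact fun j => (hM.update_nom i j.1).regular
    · intro k hk j
      rw [Function.update_of_ne]
      rintro rfl
      exact hφ hk
    · refine fun j => h V _ (hM.update_nom i j.1) fun e he => ?_
      rcases Finset.mem_union.1 he with he | he
      · exact (holds_update_nom (by simpa [Ineq.NomOcc] using hS e he) _).2 (hprem e he)
      · exact Finset.mem_singleton.1 he ▸ j.2

theorem validSystem_approx_right (hF : F.IsFull) {S : Finset (Ineq P N)} {C : Ctx P N}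
    {γ φ : MForm P N} {i : N} (hC : C.IsSLR .neg)
    (hi : ¬ System.NomOcc i ⟨S, ⟨φ, C.fill γ⟩⟩) :
    F.ValidSystem ⟨S, ⟨φ, C.fill γ⟩⟩ ↔
      F.ValidSystem ⟨S ∪ {approximation i γ (C.holeSign .neg)},
        ⟨φ, C.fill (approximant i (C.holeSign .neg))⟩⟩ := by
  simp only [System.NomOcc, Ineq.NomOcc, not_or, not_exists, not_and] at hi
  obtain ⟨hS, hφ, hψ⟩ := hi
  constructor
  · intro h V U hM hprem x hx
    simp only [Finset.mem_union, Finset.mem_singleton] at hprem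
    exact imp_sat_fill (r := .neg) C (imp_approximant (hprem _ (.inr rfl))) x
      (h V U hM (fun e he => hprem e (.inl he)) x hx)
  · intro h V U hM hprem
    refine holds_right_of_detects (fun j x => (sat_update_nom hφ _ x).2)
      (detects_fill hF hM.regular ?_ C hC ?_
        (detects_approximant hF hM (fun h => hψ (nomOcc_of_nomOcc_fill h)) _)) ?_
    · exact fun j => (hM.update_nom i j.1).regular
    · intro k hk j
      rw [Function.update_of_ne]
      rintro rfl
      exact hψ hk
    · refine fun j => h V _ (hM.update_nom i j.1) fun e he => ?_
      rcases Finset.mem_union.1 he with he | he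
      · exact (holds_update_nom (by simpa [Ineq.NomOcc] using hS e he) _).2 (hprem e he)
      · exact Finset.mem_singleton.1 he ▸ j.2

end Approximation

/-! ### Ackermann rules -/

section Ackermann

variable [DecidableEq P] [DecidableEq N]

/-- The common form of the two Ackermann rules: `θ` is the extremal value of `p` that satisfies
the premises `A`, and the premises `B` are antitone in the distance of `p` from that value. -/
theorem validSystem_ackermann (hF : F.IsFull) {p : P} {θ : MForm P N} {A B : Finset (Ineq P N)}
    {c : Ineq P N} (hc : ¬ c.Occ p)
    (hA : ∀ V U, IsModel V U →
      ∀ e ∈ A, F.Holds (Function.update V p {y | F.Sat V U y θ}) U e)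
    (hB : ∀ V U, IsModel V U → (∀ e ∈ A, F.Holds V U e) →
      ∀ e ∈ B, F.Holds V U e → F.Holds (Function.update V p {y | F.Sat V U y θ}) U e) :
    F.ValidSystem ⟨A ∪ B, c⟩ ↔ F.ValidSystem ⟨B.image (Ineq.subst p θ), c⟩ := by
  simp only [ValidSystem, Finset.forall_mem_union, Finset.forall_mem_image, holds_subst]
  constructor
  · intro h V U hM hprem
    -- The conclusion does not contain `p`, so the model may be moved to the extremal value of `p`,
    -- where the premises `A` hold automatically.
    rw [← holds_update_prop hc {y | F.Sat V U y θ}]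
    exact h _ U (hM.update_prop p (sat_isRO hF hM.regular θ)) ⟨hA V U hM, fun e he => hprem he⟩
  · exact fun h V U hM hprem => h V U hM fun e he => hB V U hM hprem.1 e he (hprem.2 e he)

theorem validSystem_redStep (hF : F.IsFull) {s t : System P N} (h : RedStep s t) :
    F.ValidSystem s ↔ F.ValidSystem t := by
  cases h with
  | approxLeftPos S C γ ψ i hC hs hγ hi =>
    simpa only [hs, approximant, approximation] using validSystem_approx_left hF hC hi
  | approxLeftNeg S C γ ψ i hC hs hγ hi =>
    simpa only [hs, approximant, approximation] using validSystem_approx_left hF hC hi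
  | approxRightPos S C γ φ i hC hs hγ hi =>
    simpa only [hs, approximant, approximation] using validSystem_approx_right hF hC hi
  | approxRightNeg S C γ φ i hC hs hγ hi =>
    simpa only [hs, approximant, approximation] using validSystem_approx_right hF hC hi
  | resid S c e e' he h =>
    refine forall₃_congr fun V U hM => imp_congr_left (forall_mem_erase_union he ?_)
    simpa using holds_resid hF hM.regular h
  | split S c e T he h =>
    exact forall₃_congr fun V U hM =>
      imp_congr_left (forall_mem_erase_union he (holds_split hF hM.regular h))
  | rightAckermann p αs B c hα hc hB =>
    refine validSystem_ackermann hF hc (fun V U hM e he => ?_) fun V U hM hA e he h x hx => ?_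
    · obtain ⟨α, hmem, rfl⟩ := List.mem_map.1 (List.mem_toFinset.1 he)
      intro x hx
      simpa [Sat] using
        sat_bigOr hF hM.regular hmem ((sat_update_prop (hα α hmem) _ x).1 hx)
    -- The premises `αᵢ ≤ p` bound the join by `p`; lowering `p` to it shrinks the left sides of `B`
    -- and enlarges the right sides. The left rule is the dual, raising `p` to the meet.
    · have hs : {y | F.Sat V U y (.bigOr αs)} ⊆ V p :=
        holds_bigOr (b := .prop p) hF hM.regular fun α hα =>
          hA _ (List.mem_toFinset.2 (List.mem_map_of_mem hα))
      exact sat_of_negativeIn (hB e he).2 hs (h x (sat_of_positiveIn' (hB e he).1 hs hx))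
  | leftAckermann p αs B c hα hc hB =>
    refine validSystem_ackermann hF hc (fun V U hM e he => ?_) fun V U hM hA e he h x hx => ?_
    · obtain ⟨α, hmem, rfl⟩ := List.mem_map.1 (List.mem_toFinset.1 he)
      intro x hx
      simp only [Sat, Function.update_self] at hx
      exact (sat_update_prop (hα α hmem) _ x).2 (sat_bigAnd.1 hx α hmem)
    · have hs : V p ⊆ {y | F.Sat V U y (.bigAnd αs)} := fun y hy =>
        sat_bigAnd.2 fun α hα => hA _ (List.mem_toFinset.2 (List.mem_map_of_mem hα)) y hy
      exact sat_of_positiveIn (hB e he).2 hs (h x (sat_of_negativeIn' (hB e he).1 hs hx))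

theorem validSystem_reduce (hF : F.IsFull) {s t : System P N}
    (h : Relation.ReflTransGen RedStep s t) : F.ValidSystem s ↔ F.ValidSystem t := by
  induction h with
  | refl => rfl
  | tail _ h ih => exact ih.trans (validSystem_redStep hF h)

end Ackermann

theorem validSystem_empty (hF : F.IsFull) {e : Ineq P N} :
    F.ValidSystem ⟨∅, e⟩ ↔ F.Valid e := by
  simp [ValidSystem, hF.valid_iff]

end PossibilityFrame

/-! ## Correctness of the first-order translation -/

namespace PossibilityFrame

variable {N : Type v} {W : Type w} [PartialOrder W] {F : PossibilityFrame W}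

section Realize

variable {n : ℕ} {v : N → W} {xs : Fin n → W}

theorem realize_fRef (x y : Fin n) :
    letI := F.toStructure
    (fRef x y : (corrLang Empty).BoundedFormula N n).Realize v xs ↔ xs x ≤ xs y := by
  let := F.toStructure
  rw [fRef, BoundedFormula.realize_rel₂]
  rfl

theorem realize_fAcc (x y : Fin n) :
    letI := F.toStructure
    (fAcc x y : (corrLang Empty).BoundedFormula N n).Realize v xs ↔ F.R (xs x) (xs y) := by
  let := F.toStructure
  rw [fAcc, BoundedFormula.realize_rel₂]
  rfl

theorem realize_fEq (i : N) (x : Fin n) :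
    letI := F.toStructure
    (fEq i x : (corrLang Empty).BoundedFormula N n).Realize v xs ↔ v i = xs x :=
  Iff.rfl

variable {A : (corrLang Empty).BoundedFormula N (n + 1)} {x : Fin n}

theorem realize_allBelow :
    letI := F.toStructure
    (allBelow x A).Realize v xs ↔ ∀ y ≤ xs x, A.Realize v (Fin.snoc xs y) := by
  simp [allBelow, realize_fRef]

theorem realize_exBelow :
    letI := F.toStructure
    (exBelow x A).Realize v xs ↔ ∃ y ≤ xs x, A.Realize v (Fin.snoc xs y) := by
  simp [exBelow, realize_fRef]

theorem realize_allAbove :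
    letI := F.toStructure
    (allAbove x A).Realize v xs ↔ ∀ y, xs x ≤ y → A.Realize v (Fin.snoc xs y) := by
  simp [allAbove, realize_fRef]

theorem realize_exAbove :
    letI := F.toStructure
    (exAbove x A).Realize v xs ↔ ∃ y, xs x ≤ y ∧ A.Realize v (Fin.snoc xs y) := by
  simp [exAbove, realize_fRef]

theorem realize_allSucc :
    letI := F.toStructure
    (allSucc x A).Realize v xs ↔ ∀ y, F.R (xs x) y → A.Realize v (Fin.snoc xs y) := by
  simp [allSucc, realize_fAcc]

theorem realize_exSucc :
    letI := F.toStructure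
    (exSucc x A).Realize v xs ↔ ∃ y, F.R (xs x) y ∧ A.Realize v (Fin.snoc xs y) := by
  simp [exSucc, realize_fAcc]

theorem realize_allPred :
    letI := F.toStructure
    (allPred x A).Realize v xs ↔ ∀ y, F.R y (xs x) → A.Realize v (Fin.snoc xs y) := by
  simp [allPred, realize_fAcc]

theorem realize_exPred :
    letI := F.toStructure
    (exPred x A).Realize v xs ↔ ∃ y, F.R y (xs x) ∧ A.Realize v (Fin.snoc xs y) := by
  simp [exPred, realize_fAcc]

end Realize

/-- An individual variable denotes a point and its nominal the regular open closure of that point.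
`Fin.snoc_last` evaluates each newly bound variable, and `mem_ro_singleton` settles the nominal
case. -/
theorem realize_ST (V : Empty → Set W) (v : N → W) (φ : MForm Empty N) {n : ℕ} (x : Fin n)
    (xs : Fin n → W) :
    letI := F.toStructure
    (ST φ x).Realize v xs ↔ F.Sat V (fun i => ro {v i}) (xs x) φ := by
  let := F.toStructure
  induction φ generalizing n with
  | prop q => exact q.elim
  | nom i =>
    simp only [ST, roClosure, realize_allBelow, realize_exBelow, realize_exAbove, realize_fEq,
      Fin.snoc_last, Sat, mem_ro_singleton]
  | top => simp [ST, Sat]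
  | bot => simp [ST, Sat]
  | _ =>
    simp_all only [ST, roClosure, realize_allBelow, realize_exBelow, realize_exAbove,
      realize_allAbove, realize_allSucc, realize_exSucc, realize_allPred, realize_exPred,
      BoundedFormula.realize_not, BoundedFormula.realize_inf, BoundedFormula.realize_sup,
      BoundedFormula.realize_imp, Fin.snoc_last, Sat]

theorem realize_ineq_toFO (V : Empty → Set W) (v : N → W) (e : Ineq Empty N) :
    letI := F.toStructure
    e.toFO.Realize v ↔ F.Holds V (fun i => ro {v i}) e := by
  let := F.toStructure
  rw [Formula.Realize, Ineq.toFO, BoundedFormula.realize_all]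
  simp only [BoundedFormula.realize_imp, realize_ST V, Fin.snoc_last]
  rfl

theorem realize_system_toFO (V : Empty → Set W) (v : N → W) (s : System Empty N) :
    letI := F.toStructure
    s.toFO.Realize v ↔
      ((∀ e ∈ s.prem, F.Holds V (fun i => ro {v i}) e) → F.Holds V (fun i => ro {v i}) s.concl) := by
  let := F.toStructure
  rw [System.toFO, Formula.realize_imp, Formula.realize_iInf]
  simp only [realize_ineq_toFO V, Subtype.forall]

/-! ### Universal closure and the output of a run -/

theorem realize_univClosure [DecidableEq N] [Nonempty W]
    (A : (corrLang Empty).Formula N) :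
    letI := F.toStructure
    W ⊨ univClosure A ↔ ∀ v : N → W, A.Realize v := by
  let := F.toStructure
  rw [univClosure, Sentence.Realize, Formula.realize_iAlls]
  simp only [Formula.realize_relabel]
  constructor
  · intro h v
    exact (BoundedFormula.realize_restrictFreeVar (f := id) v fun a => rfl).1 (h fun a => v a)
  · intro h v
    classical
    -- Only the variables occurring in `A` are quantified. An assignment to them is extended by an
    -- arbitrary point, which is where nonemptiness of the frame is needed.
    let v' : N → W := fun a => if ha : a ∈ A.freeVarFinset then v ⟨a, ha⟩ else Classical.arbitrary W
    exact (BoundedFormula.realize_restrictFreeVar (f := id) v' fun a => by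
      simp [v']).2 (h v')

theorem sat_ofPure {P : Type u} (V : P → Set W) (V₀ : Empty → Set W) (U : N → Set W)
    (φ : MForm Empty N) (x : W) : F.Sat V U x φ.ofPure ↔ F.Sat V₀ U x φ := by
  induction φ generalizing x with
  | prop q => exact q.elim
  | _ => simp_all only [MForm.ofPure, Sat]

theorem validSystem_ofPure {P : Type u} [DecidableEq P] [DecidableEq N] (s : System Empty N) :
    F.ValidSystem (System.ofPure s : System P N) ↔ F.Models (univClosure s.toFO) := by
  let := F.toStructure
  have := F.nonempty
  have holds (V : P → Set W) (U : N → Set W) (e : Ineq Empty N) :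
      F.Holds V U ⟨e.lhs.ofPure, e.rhs.ofPure⟩ ↔ F.Holds (fun _ => ∅) U e :=
    forall_congr' fun x => imp_congr (sat_ofPure V _ U _ x) (sat_ofPure V _ U _ x)
  rw [Models, realize_univClosure]
  simp only [realize_system_toFO fun _ => ∅]
  simp only [ValidSystem, System.ofPure, Finset.forall_mem_image, holds]
  constructor
  · exact fun h v => h (fun _ => ∅) _ ⟨fun _ => isRO_empty, fun i => ⟨v i, rfl⟩⟩
  · intro h V U hM
    -- Choosing a generating point for each nominal turns the interpretation of nominals into an
    -- assignment of individual variables.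
    choose v hv using hM.nom
    obtain rfl : U = fun i => ro {v i} := funext hv
    exact h v

theorem models_FO [DecidableEq N] (l : List (System Empty N)) :
    F.Models (FO l) ↔ ∀ s ∈ l, F.Models (univClosure s.toFO) := by
  simp only [Models, Sentence.Realize, Formula.Realize, FO, BoundedFormula.realize_foldr_inf,
    List.forall_mem_map]

/-- Soundness of a run: validity of an inequality on a full frame is the truth of the output. -/
theorem IsFull.valid_iff_models {P : Type u} [DecidableEq P] [DecidableEq N] (hF : F.IsFull)
    {e : Ineq P N} {A : (corrLang Empty).Sentence} (hA : Outputs e A) :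
    F.Valid e ↔ F.Models A := by
  obtain ⟨l, sys, hpre, hred, rfl⟩ := hA
  have hl := valid_preprocess hF hpre
  simp only [Finset.mem_singleton, forall_eq, List.mem_toFinset] at hl
  rw [hl, models_FO]
  clear hl hpre
  induction hred with
  | nil => simp
  | cons h _ ih =>
    rw [List.forall_mem_cons, List.forall_mem_cons]
    refine and_congr ?_ ih
    rw [← validSystem_empty hF, validSystem_reduce hF h, validSystem_ofPure]

end PossibilityFrame

end PossALBA

theorem mainTheorem1 {P : Type*} {N : Type*} [DecidableEq P] [DecidableEq N]
    (φ ψ : PossALBA.MForm P N) (hφ : φ.IsBasic) (hψ : ψ.IsBasic)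
    (A : (PossALBA.corrLang Empty).Sentence) (hA : PossALBA.Outputs ⟨φ, ψ⟩ A)
    {W : Type*} [PartialOrder W] (F : PossALBA.PossibilityFrame W) (hF : F.IsFull) :
    F.Valid (⟨φ, ψ⟩ : PossALBA.Ineq P N) ↔ F.Models A :=
  hF.valid_iff_models hA
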